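/- **Setting.** Let $\mathbb F$ be a field, $k\ge 2$, and let $P(\lambda)=\sum_{i=0}^k A_i\lambda^i\in\mathbb F[\lambda]^{n\times n}$ be a matrix polynomial of grade $k$ ($A_k=0$ is allowed). All $k\times k$ block-matrices have $n\times n$ blocks; $H^{\mathcal B}$ denotes the block-transpose of $H$ (block $(i,j)$ of $H^{\mathcal B}$ is block $(j,i)$ of $H$). For a permutation $\mathbf c$ of $\{1,\dots,k\}$, $\Pi^n_{\mathbf c}$ is the block-matrix whose blocks in positions $(\mathbf c(i),i)$ are $I_n$ and whose other blocks are $0$. A pencil is a matrix polynomial of grade $1$. *Elementary matrices.* For $B\in\mathbb F^{n\times n}$ let $M_0(B)=I_{(k-1)n}\oplus B$, $M_{-k}(B)=B\oplus I_{(k-1)n}$ and, for $1\le i\le k-1$, $$M_i(B)=I_{(k-i-1)n}\oplus\begin{bmatrix}B&I_n\\I_n&0\end{bmatrix}\oplus I_{(i-1)n},\qquad M_{-i}(B)=I_{(k-i-1)n}\oplus\begin{bmatrix}0&I_n\\I_n&B\end{bmatrix}\oplus I_{(i-1)n}.$$ Put $M^P_0=M_0(-A_0)$ and $M^P_{-i}=M_{-i}(A_i)$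 for $1\le i\le k$. For an index tuple $\mathbf t=(t_1,\dots,t_r)$ and a matrix assignment $\mathcal X=(X_1,\dots,X_r)$ of $n\times n$ matrices, $M_{\mathbf t}(\mathcal X)=M_{t_1}(X_1)\cdots M_{t_r}(X_r)$ and $M^P_{\mathbf t}=M^P_{t_1}\cdots M^P_{t_r}$ (empty products are $I_{kn}$). *Tuples and heads.* A tuple satisfies the SIP if between any two equal indices $i$ there is an index $i+1$. Two tuples of nonnegative integers are equivalent if one arises from the other by finitely many interchanges of adjacent indices $x\ne y$ with $|x-y|\neq1$. A tuple of nonnegative integers that satisfies the SIP is equivalent to a unique tuple $(a_s:b_s,\dots,a_1:b_1)$ with $b_s>\cdots>b_1\ge0$ and $0\le a_j\le b_j$, where $(a:b)=(a,a+1,\dots,b)$; its number of heads is $\mathfrak h(\mathbf t)=s$. Write $k+\mathbf t$ for the tuple obtained by adding $k$ to every index and $\mathrm{rev}(\mathbf t)$ for the reversed tuple. *Wing pencils and the AS condition.* With $\Lambda_s(\lambda)=[\lambda^s,\dots,\lambda,1]$, an $(s,n)$-wing pencil is a pencil $K(\lambda)$ of size $sn\times(s+1)n$ with $K(\lambda)(\Lambda_s(\lambda)^T\otimes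 I_n)=0$. A pencil $N(\lambda)=\lambda N_1+N_0$ with $(q+1)\times(p+1)$ blocks of size $n\times n$, $p+q+1=k$, satisfies the AS condition for $P$ if $$\sum_{i+j=k+2-s}[N_1]_{ij}+\sum_{i+j=k+1-s}[N_0]_{ij}=A_s,\qquad s=0,\dots,k.$$ **Theorem 8.3.** Let $\mathbf z$ be a permutation of $\{-k,\dots,-1\}$, let $\boldsymbol\ell_z,\mathbf r_z$ be tuples with indices from $\{-k,\dots,-2\}$ such that $(\boldsymbol\ell_z,\mathbf z,\mathbf r_z)$ satisfies the SIP, let $\mathcal Z,\mathcal W$ be $n\times n$ matrix assignments for $\boldsymbol\ell_z,\mathbf r_z$, and let $$L_P(\lambda)=M_{\boldsymbol\ell_z}(\mathcal Z)\,(\lambda M^P_{\mathbf z}-M^P_0)\,M_{\mathbf r_z}(\mathcal W)$$ be the corresponding generalized Fiedler pencil with repetition. Put $p=\mathfrak h(k+\mathbf z)-1$ and $q=\mathfrak h(\mathrm{rev}(k+\mathbf z))-1$. Then $p+q+1=k$, and there exist permutations $\boldsymbol\ell,\mathbf r$ of $\{1,\dots,k\}$ such that $$C(\lambda):=(\Pi^n_{\boldsymbol\ell})^{\mathcal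 B}L_P(\lambda)\Pi^n_{\mathbf r}=\begin{bmatrix}0&L_1(\lambda)\\L_2(\lambda)^T&N(\lambda)\end{bmatrix},$$ where $L_1(\lambda)$ is a $(p,n)$-wing pencil, $L_2(\lambda)$ is a $(q,n)$-wing pencil, and $N(\lambda)$ is a pencil with $(q+1)\times(p+1)$ blocks of size $n\times n$ that satisfies the AS condition for $P(\lambda)$. Moreover, $\boldsymbol\ell(k)=k$ and $\mathbf r(k)=k$, so that the last block-row of $C(\lambda)$ is the last block-row of $L_P(\lambda)\Pi^n_{\mathbf r}$ and the last block-column of $C(\lambda)$ is the last block-column of $(\Pi^n_{\boldsymbol\ell})^{\mathcal B}L_P(\lambda)$. Additionally, the block of $N(\lambda)$ in position $(q+1,p+1)$ equals $\lambda A_1+A_0$. -/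

import Mathlib

open scoped Matrix

noncomputable section

namespace GFPR

/-! ### Index tuples -/

/-- The successor infix property (SIP): between any two equal indices there is
an index that is larger by one. -/
def SIP (t : List ℤ) : Prop :=
  ∀ a b : Fin t.length, a < b → t.get a = t.get b →
    ∃ c : Fin t.length, a < c ∧ c < b ∧ t.get c = t.get a + 1

/-- `t'` arises from `t` by interchanging two adjacent, distinct, commuting indices. -/
def CommSwap (t t' : List ℤ) : Prop :=
  ∃ (u v : List ℤ) (x y : ℤ), x ≠ y ∧ |x - y| ≠ 1 ∧
    t = u ++ x :: y :: v ∧ t' = u ++ y :: x :: v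

/-- Equivalence of index tuples: finitely many interchanges of commuting neighbours. -/
def TupleEquiv (t t' : List ℤ) : Prop := Relation.ReflTransGen CommSwap t t'

/-- The string `(a : b) = (a, a + 1, …, b)`; it is empty if `b < a`. -/
def string (a b : ℤ) : List ℤ :=
  (List.range (b + 1 - a).toNat).map (fun i => a + (i : ℤ))

/-- The strings `(a_s : b_s), …, (a_1 : b_1)`, listed from left to right as pairs `(a_j, b_j)`,
are those of a tuple in column standard form:
`b_s > ⋯ > b_1 ≥ 0` and `0 ≤ a_j ≤ b_j` for all `j`. -/
def IsColumnStandard (S : List (ℤ × ℤ)) : Prop :=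
  (∀ ab ∈ S, 0 ≤ ab.1 ∧ ab.1 ≤ ab.2) ∧ S.Pairwise (fun ab cd => cd.2 < ab.2)

/-- The concatenation of the strings in a list. -/
def concatStrings (S : List (ℤ × ℤ)) : List ℤ := S.flatMap (fun ab => string ab.1 ab.2)

/-- The heads of a tuple: the right end points of the strings of the (unique) tuple in column
standard form that is equivalent to it. -/
def heads (t : List ℤ) : Set ℤ :=
  {b | ∃ S : List (ℤ × ℤ), IsColumnStandard S ∧ TupleEquiv t (concatStrings S) ∧
    ∃ a : ℤ, (a, b) ∈ S}

/-- The number `𝔥(t)` of heads of a tuple. -/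
def numHeads (t : List ℤ) : ℕ := (heads t).ncard

/-- The shifted tuple `a + t`. -/
def shift (a : ℤ) (t : List ℤ) : List ℤ := t.map (fun i => a + i)

/-! ### Block matrices

A block matrix with `p × q` blocks of size `n × n` over `R` is a `p × q` matrix with entries in
the ring of `n × n` matrices. In this form the outer transpose `Hᵀ` is the block transpose of `H`
(blocks change places but are not transposed themselves). -/

/-- `p × q` block matrices with `n × n` blocks. -/
abbrev BlockMatrix (p q n : ℕ) (R : Type*) : Type _ :=
  Matrix (Fin p) (Fin q) (Matrix (Fin n) (Fin n) R)

/-- The ordinary transpose of a block matrix: blocks change places and are transposed. -/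
def fullTranspose {p q n : ℕ} {R : Type*} (H : BlockMatrix p q n R) : BlockMatrix q p n R :=
  Matrix.of fun i j => (H j i)ᵀ

/-- The block-permutation matrix of `c`: the block in position `(c i, i)` is the identity, all
other blocks vanish. -/
def blockPerm {k : ℕ} (n : ℕ) (R : Type*) [CommRing R] (c : Equiv.Perm (Fin k)) :
    BlockMatrix k k n R :=
  Matrix.of fun a b => if a = c b then 1 else 0

section Coefficients

variable {F : Type*} [Field F]

/-- A constant block matrix, regarded as a block matrix with polynomial entries. -/
def const {p q n : ℕ} (M : BlockMatrix p q n F) : BlockMatrix p q n (Polynomial F) :=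
  M.map (fun B => B.map Polynomial.C)

/-- The coefficient `A_i` of `λ ^ i` in a matrix polynomial. -/
def coeffMatrix {n : ℕ} (P : Matrix (Fin n) (Fin n) (Polynomial F)) (i : ℕ) :
    Matrix (Fin n) (Fin n) F :=
  P.map (fun f => f.coeff i)

/-- The matrix polynomial `P` has grade `k`: it is of the form `∑_{i = 0}^k A_i λ ^ i`. -/
def HasGrade {n : ℕ} (P : Matrix (Fin n) (Fin n) (Polynomial F)) (k : ℕ) : Prop :=
  ∀ i j, (P i j).natDegree ≤ k

/-- A block pencil: every block is of the form `λ B₁ + B₀`. -/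
def IsPencil {p q n : ℕ} (M : BlockMatrix p q n (Polynomial F)) : Prop :=
  ∀ i j, HasGrade (M i j) 1

/-- The matrix `Λ_s(λ)ᵀ ⊗ I_n`, where `Λ_s(λ) = [λ ^ s, …, λ, 1]`. -/
def Lam (F : Type*) [Field F] (s n : ℕ) : BlockMatrix (s + 1) 1 n (Polynomial F) :=
  Matrix.of fun j _ => (Polynomial.X : Polynomial F) ^ (s - (j : ℕ)) • 1

/-- `K` is an `(s, n)`-wing pencil: a pencil with `K(λ) (Λ_s(λ)ᵀ ⊗ I_n) = 0`. -/
def IsWingPencil {s n : ℕ} (K : BlockMatrix s (s + 1) n (Polynomial F)) : Prop :=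
  IsPencil K ∧ K * Lam F s n = 0

/-- The antidiagonal sum `AS(M, s)` of the pencil `M = λ M₁ + M₀` with `(q + 1) × (p + 1)` blocks:
with `k = p + q + 1` and block positions counted from `1`, the sum of the blocks of `M₁` on
`i + j = k + 2 - s` and of the blocks of `M₀` on `i + j = k + 1 - s`. -/
def antidiagSum {p q n : ℕ} (M : BlockMatrix (q + 1) (p + 1) n (Polynomial F)) (s : ℕ) :
    Matrix (Fin n) (Fin n) F :=
  (∑ i : Fin (q + 1), ∑ j : Fin (p + 1),
    if ((i : ℕ) + 1) + ((j : ℕ) + 1) + s = (p + q + 1) + 2 then coeffMatrix (M i j) 1 else 0) +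
  (∑ i : Fin (q + 1), ∑ j : Fin (p + 1),
    if ((i : ℕ) + 1) + ((j : ℕ) + 1) + s = (p + q + 1) + 1 then coeffMatrix (M i j) 0 else 0)

/-- The pencil `M` satisfies the AS condition for the matrix polynomial `P` of grade
`k = p + q + 1`. -/
def ASCondition {p q n : ℕ} (M : BlockMatrix (q + 1) (p + 1) n (Polynomial F))
    (P : Matrix (Fin n) (Fin n) (Polynomial F)) : Prop :=
  ∀ s : ℕ, s ≤ p + q + 1 → antidiagSum M s = coeffMatrix P s

/-! ### Elementary matrices and their products -/

/-- The elementary matrix `M_i(B)` with `k × k` blocks, for `-k ≤ i ≤ k - 1`; the index `0` is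
the "positive" zero. Block rows `a + 1` and block columns `b + 1` are counted from `1`.
(Indices outside `{-k : k - 1}` are never used; they give the identity.) -/
def elem (k : ℕ) {n : ℕ} (i : ℤ) (B : Matrix (Fin n) (Fin n) F) : BlockMatrix k k n F :=
  Matrix.of fun a b =>
    let r : ℤ := (a : ℤ) + 1
    let c : ℤ := (b : ℤ) + 1
    if i = 0 then
      -- `I_{(k-1)n} ⊕ B`
      if r = k ∧ c = k then B else if r = c then 1 else 0
    else if i = -(k : ℤ) then
      -- `B ⊕ I_{(k-1)n}`
      if r = 1 ∧ c = 1 then B else if r = c then 1 else 0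
    else if 1 ≤ i ∧ i ≤ (k : ℤ) - 1 then
      -- `I_{(k-i-1)n} ⊕ [B, I; I, 0] ⊕ I_{(i-1)n}`
      if r = k - i ∧ c = k - i then B
      else if r = k - i + 1 ∧ c = k - i + 1 then 0
      else if (r = k - i ∧ c = k - i + 1) ∨ (r = k - i + 1 ∧ c = k - i) then 1
      else if r = c then 1 else 0
    else if 1 ≤ -i ∧ -i ≤ (k : ℤ) - 1 then
      -- with `i' = -i`: `I_{(k-i'-1)n} ⊕ [0, I; I, B] ⊕ I_{(i'-1)n}`
      if r = k + i ∧ c = k + i then 0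
      else if r = k + i + 1 ∧ c = k + i + 1 then B
      else if (r = k + i ∧ c = k + i + 1) ∨ (r = k + i + 1 ∧ c = k + i) then 1
      else if r = c then 1 else 0
    else if r = c then 1 else 0

/-- The product `M_t(𝒳) = M_{t_1}(X_1) ⋯ M_{t_r}(X_r)` for an index tuple `t` and a matrix
assignment `𝒳` of the same length. The empty product is the identity. -/
def elemProd (k : ℕ) {n : ℕ} (t : List ℤ) (Xs : List (Matrix (Fin n) (Fin n) F)) :
    BlockMatrix k k n F :=
  (List.zipWith (fun i B => elem k i B) t Xs).prod

/-- `M_i^P`: this is `M_i(-A_i)` for `i ≥ 0` and `M_i(A_{-i})` for `i < 0`. -/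
def elemP (k : ℕ) {n : ℕ} (P : Matrix (Fin n) (Fin n) (Polynomial F)) (i : ℤ) :
    BlockMatrix k k n F :=
  if 0 ≤ i then elem k i (-coeffMatrix P i.natAbs) else elem k i (coeffMatrix P i.natAbs)

/-- `M_t^P = M_{t_1}^P ⋯ M_{t_r}^P`. -/
def elemProdP (k : ℕ) {n : ℕ} (P : Matrix (Fin n) (Fin n) (Polynomial F)) (t : List ℤ) :
    BlockMatrix k k n F :=
  (t.map (elemP k P)).prod

/-- The pencil `M_{ℓ_z}(𝒵) (λ M_z^P - M_0^P) M_{r_z}(𝒲)`. -/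
def leftPencil (k : ℕ) {n : ℕ} (P : Matrix (Fin n) (Fin n) (Polynomial F))
    (z lz rz : List ℤ) (Z W : List (Matrix (Fin n) (Fin n) F)) :
    BlockMatrix k k n (Polynomial F) :=
  const (elemProd k lz Z) *
    ((Polynomial.X : Polynomial F) • const (elemProdP k P z) - const (elemP k P 0)) *
    const (elemProd k rz W)

/-- The `k × k` block matrix `[0, L₁; L₂ᵀ, N]`, with `p + (q + 1) = k` block rows and
`q + (p + 1) = k` block columns. -/
def reversedPencil {k p q n : ℕ} (hrow : p + (q + 1) = k) (hcol : q + (p + 1) = k)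
    (L₁ : BlockMatrix p (p + 1) n (Polynomial F)) (L₂ : BlockMatrix q (q + 1) n (Polynomial F))
    (N : BlockMatrix (q + 1) (p + 1) n (Polynomial F)) : BlockMatrix k k n (Polynomial F) :=
  Matrix.reindex (finSumFinEquiv.trans (finCongr hrow)) (finSumFinEquiv.trans (finCongr hcol))
    (Matrix.fromBlocks 0 L₁ (fullTranspose L₂) N)

end Coefficients

end GFPR

end

open GFPR

/-! Everything takes place over an algebra `𝒜` with a central scalar `x` (later the `n × n`
polynomial matrices and `X`), so that one block is one entry. Instead of exhibiting `[0, L₁; L₂ᵀ,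
N]` at once, each row and each column is labelled either as wing (`none`, weight `0`) or as body of
level `d` (weight `x ^ d`). `WingStructure` says that wing rows and wing columns are annihilated by
the weights, that they meet in zeros, and that the doubly weighted sum of all entries is a
prescribed element `T`. Sorting the body rows and columns by decreasing level then yields the wing
pencils. Since the weights become `Λ_q` and `Λ_p`, the AS condition is comparison of coefficients in
`Λ_q N Λ_pᵀ = P`.

After the shift by `k`, the factors with indices in `{m : k - 1}` of a Fiedler pencil can be treated
by downward recursion on `m`. The factor `m` commutes with all larger ones except `m + 1`. It can
therefore be moved to the right end if `m + 1` precedes `m`, and to the left end otherwise. On the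
left it turns row `m` into a body row of a new top level and column `m` into a wing column; on the
right the roles are exchanged. Either way the weighted sum gains the next term `x ^ s • A s`
(`PartialFiedler.stepMatrix_mul`, `PartialFiedler.mul_stepMatrix`). Up to the last index, the row
`j` is a wing row exactly when `j + 1` precedes `j`, and these `j` together with `k - 1` are the
heads of the tuple (`heads_eq`).

A further factor `j` on the left exchanges the rows `j - 1` and `j` and adds a left multiple of the
old row `j`. This is harmless if row `j` is a wing row. The SIP guarantees it: a repeated `j` must
be preceded by `j + 1` in the tuple already present (`WingStructure.zipWith_mul`). Factors on the
right are reduced to factors on the left by the block transpose over `𝒜ᵐᵒᵖ`, which reverses tuples.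
No extra factor has index `k - 1`, hence the last row and the last column keep their level `0` and
the corner keeps its value. -/

noncomputable section

namespace GFPR

/-! ### Elementary row operations, wing structures, and the recursion step for Fiedler pencils -/

section BlockOperations

open MulOpposite

variable {K 𝒜 ℬ : Type*} [CommRing K] [Ring 𝒜] [Algebra K 𝒜] [Ring ℬ] [Algebra K ℬ] {k : ℕ}

/-- The elementary matrix that acts as `[0, 1; 1, B]` on the rows `j - 1` and `j` (counted from
`0`); for `j = 0` it multiplies row `0` by `B`. -/
def stepMatrix (k : ℕ) (j : ℤ) (B : 𝒜) : Matrix (Fin k) (Fin k) 𝒜 :=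
  Matrix.of fun a b =>
    if ((a : ℤ) + 1 = j ∧ (b : ℤ) = j) ∨ ((a : ℤ) = j ∧ (b : ℤ) + 1 = j) then 1
    else if (a : ℤ) = j ∧ (b : ℤ) = j then B
    else if (a : ℤ) + 1 = j ∧ (b : ℤ) + 1 = j then 0
    else if a = b then 1 else 0

theorem stepMatrix_sub_one_apply_eq_zero {j : ℤ} {B : 𝒜} {a b : Fin k}
    (h : ¬(((a : ℤ) = j ∨ (a : ℤ) + 1 = j) ∧ ((b : ℤ) = j ∨ (b : ℤ) + 1 = j))) :
    (stepMatrix k j B - 1) a b = 0 := by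
  have h1 : ¬(((a : ℤ) + 1 = j ∧ (b : ℤ) = j) ∨ ((a : ℤ) = j ∧ (b : ℤ) + 1 = j)) := by tauto
  have h2 : ¬((a : ℤ) = j ∧ (b : ℤ) = j) := by tauto
  have h3 : ¬((a : ℤ) + 1 = j ∧ (b : ℤ) + 1 = j) := by tauto
  simp [stepMatrix, h1, h2, h3, Matrix.one_apply]

/-- The differences from the identity are supported on the disjoint index sets `{i - 1, i}` and `{j
- 1, j}`, so their products vanish in both orders. -/
theorem stepMatrix_commute {i j : ℤ} (hij : i + 2 ≤ j ∨ j + 2 ≤ i) (B C : 𝒜) :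
    Commute (stepMatrix k i B) (stepMatrix k j C) := by
  have key : ∀ (i j : ℤ) (B C : 𝒜), (i + 2 ≤ j ∨ j + 2 ≤ i) →
      (stepMatrix k i B - 1) * (stepMatrix k j C - 1) = 0 := by
    intro i j B C h
    ext a b
    rw [Matrix.mul_apply]
    refine Finset.sum_eq_zero fun c _ => ?_
    by_cases hc : (c : ℤ) = i ∨ (c : ℤ) + 1 = i
    · rw [stepMatrix_sub_one_apply_eq_zero (j := j), mul_zero]
      omega
    · rw [stepMatrix_sub_one_apply_eq_zero (j := i), zero_mul]
      tauto
  have h1 : Commute (stepMatrix k i B - 1) (stepMatrix k j C - 1) := by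
    rw [Commute, SemiconjBy, key i j B C hij, key j i C B hij.symm]
  simpa using (h1.add_left (Commute.one_left _)).add_right (Commute.one_right _)

theorem stepMatrix_mul_apply_of_ne {j : ℤ} {B : 𝒜} {M : Matrix (Fin k) (Fin k) 𝒜} {a b : Fin k}
    (h1 : (a : ℤ) ≠ j) (h2 : (a : ℤ) + 1 ≠ j) : (stepMatrix k j B * M) a b = M a b := by
  rw [Matrix.mul_apply, Finset.sum_eq_single a]
  · simp [stepMatrix, h1, h2]
  · intro c _ hc
    simp [stepMatrix, h1, h2, hc.symm]
  · simp

theorem stepMatrix_mul_apply_pred {j : ℤ} {B : 𝒜} {M : Matrix (Fin k) (Fin k) 𝒜} {a b w : Fin k}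
    (hw : (w : ℤ) = j) (h : (a : ℤ) + 1 = j) : (stepMatrix k j B * M) a b = M w b := by
  rw [Matrix.mul_apply, Finset.sum_eq_single w]
  · simp [stepMatrix, hw, h]
  · intro c _ hc
    have h1 : (c : ℤ) ≠ j := fun h' => hc (Fin.ext (by omega))
    have h2 : (a : ℤ) ≠ j := by omega
    by_cases h3 : (c : ℤ) + 1 = j
    · simp [stepMatrix, h, h1, h2, h3]
    · have h4 : a ≠ c := by rintro rfl; exact h3 h
      simp [stepMatrix, h1, h2, h3, h4]
  · simp

theorem stepMatrix_mul_apply_self {j : ℤ} {B : 𝒜} {M : Matrix (Fin k) (Fin k) 𝒜} {w b c : Fin k}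
    (hw : (w : ℤ) = j) (hc : (c : ℤ) + 1 = j) :
    (stepMatrix k j B * M) w b = M c b + B * M w b := by
  have hcw : c ≠ w := by rintro rfl; omega
  have h2 : (c : ℤ) ≠ j := by omega
  have h3 : (w : ℤ) + 1 ≠ j := by omega
  rw [Matrix.mul_apply, ← Finset.sum_subset (Finset.subset_univ {c, w}), Finset.sum_pair hcw]
  · simp [stepMatrix, hw, hc, h2]
  · intro a _ ha
    simp only [Finset.mem_insert, Finset.mem_singleton, not_or] at ha
    have h4 : (a : ℤ) ≠ j := fun h' => ha.2 (Fin.ext (by omega))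
    have h5 : (a : ℤ) + 1 ≠ j := fun h' => ha.1 (Fin.ext (by omega))
    simp [stepMatrix, h4, h5, Ne.symm ha.2]

theorem stepMatrix_zero_mul_apply_self {B : 𝒜} {M : Matrix (Fin k) (Fin k) 𝒜} {w b : Fin k}
    (hw : (w : ℤ) = 0) : (stepMatrix k 0 B * M) w b = B * M w b := by
  rw [Matrix.mul_apply, Finset.sum_eq_single w]
  · have h1 : (w : ℕ) = 0 := by omega
    have h2 : (w : ℤ) + 1 ≠ 0 := by omega
    simp [stepMatrix, h1]
  · intro a _ ha
    have h1 : (a : ℕ) ≠ 0 := fun h' => ha (Fin.ext (by omega))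
    have h2 : (a : ℤ) + 1 ≠ 0 := by omega
    have h3 : (w : ℤ) + 1 ≠ 0 := by omega
    simp [stepMatrix, h1, h2, h3, Ne.symm ha]
  · simp

/-- The block transpose over the opposite ring. -/
def opTranspose (M : Matrix (Fin k) (Fin k) 𝒜) : Matrix (Fin k) (Fin k) 𝒜ᵐᵒᵖ :=
  Mᵀ.map op

theorem opTranspose_mul (M N : Matrix (Fin k) (Fin k) 𝒜) :
    opTranspose (M * N) = opTranspose N * opTranspose M := by
  ext a b
  simp [opTranspose, Matrix.mul_apply]

theorem opTranspose_stepMatrix (j : ℤ) (B : 𝒜) :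
    opTranspose (stepMatrix k j B) = stepMatrix k j (op B) := by
  ext a b
  simp only [opTranspose, stepMatrix, Matrix.map_apply, Matrix.transpose_apply, Matrix.of_apply,
    and_comm, or_comm, eq_comm (a := b) (b := a)]
  split_ifs <;> simp_all

/-- The weight `x ^ d` of a body row of level `d`; wing rows have weight `0`. -/
def weight (x : K) : Option ℕ → K
  | none => 0
  | some d => x ^ d

@[simp] theorem weight_none (x : K) : weight x none = 0 := rfl

@[simp] theorem weight_some (x : K) (d : ℕ) : weight x (some d) = x ^ d := rfl

/-- Each of the levels `0, …, q` is attained exactly once, and there are no others. -/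
structure IsLevel (q : ℕ) (e : Fin k → Option ℕ) : Prop where
  le : ∀ a d, e a = some d → d ≤ q
  inj : ∀ a b d, e a = some d → e b = some d → a = b
  surj : ∀ d, d ≤ q → ∃ a, e a = some d

theorem IsLevel.comp {q : ℕ} {e : Fin k → Option ℕ} (h : IsLevel q e) (σ : Equiv.Perm (Fin k)) :
    IsLevel q (e ∘ σ) where
  le a d := h.le (σ a) d
  inj a b d h1 h2 := σ.injective (h.inj _ _ d h1 h2)
  surj d hd := by
    obtain ⟨a, ha⟩ := h.surj d hd
    exact ⟨σ.symm a, by simpa using ha⟩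

theorem IsLevel.update {q : ℕ} {e : Fin k → Option ℕ} (h : IsLevel q e) {w : Fin k}
    (hw : e w = none) : IsLevel (q + 1) (Function.update e w (some (q + 1))) where
  le a d hd := by
    by_cases haw : a = w
    · subst haw
      simp at hd
      omega
    · rw [Function.update_of_ne haw] at hd
      have := h.le a d hd
      omega
  inj a b d ha hb := by
    by_cases haw : a = w <;> by_cases hbw : b = w
    · rw [haw, hbw]
    · subst haw
      rw [Function.update_of_ne hbw] at hb
      have := h.le b d hb
      simp at ha
      omega
    · subst hbw
      rw [Function.update_of_ne haw] at ha
      have := h.le a d ha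
      simp at hb
      omega
    · rw [Function.update_of_ne haw] at ha
      rw [Function.update_of_ne hbw] at hb
      exact h.inj a b d ha hb
  surj d hd := by
    by_cases hdq : d = q + 1
    · exact ⟨w, by simp [hdq]⟩
    · obtain ⟨a, ha⟩ := h.surj d (by omega)
      have : a ≠ w := by rintro rfl; simp [hw] at ha
      exact ⟨a, by rwa [Function.update_of_ne this]⟩

/-- On the rows and columns from `m` on, `L` has the shape `[0, L₁; L₂ᵀ, N]` up to permutations
of the rows and of the columns: the rows with `e = none` and the columns with `f = none` meet in
zeros, `L₁` and `L₂` are annihilated by the weights, and the weighted sum of `N` is `T`. -/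
structure WingStructure (x : K) (m : ℕ) (e f : Fin k → Option ℕ) (L : Matrix (Fin k) (Fin k) 𝒜)
    (T : 𝒜) : Prop where
  row : ∀ a : Fin k, m ≤ a → e a = none → ∑ b, weight x (f b) • L a b = 0
  col : ∀ b : Fin k, m ≤ b → f b = none → ∑ a, weight x (e a) • L a b = 0
  zero : ∀ a b : Fin k, m ≤ a → m ≤ b → e a = none → f b = none → L a b = 0
  total : ∑ a, weight x (e a) • ∑ b, weight x (f b) • L a b = T

/-- The conditions involve only scalar weights and sums, never products in `𝒜`. Linearity of `φ`
suffices, so that `φ` may be the anti-multiplicative map `op`. -/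
theorem WingStructure.transpose {x : K} {m : ℕ} {e f : Fin k → Option ℕ}
    {L : Matrix (Fin k) (Fin k) 𝒜} {T : 𝒜} (h : WingStructure x m e f L T) (φ : 𝒜 →ₗ[K] ℬ) :
    WingStructure x m f e (Lᵀ.map φ) (φ T) where
  row a ha hfa := by simpa using congrArg φ (h.col a ha hfa)
  col b hb heb := by simpa using congrArg φ (h.row b hb heb)
  zero a b ha hb hfa heb := by simpa using congrArg φ (h.zero b a hb ha heb hfa)
  total := by
    rw [← h.total]
    simp only [Finset.smul_sum, map_sum, map_smul, Matrix.map_apply, Matrix.transpose_apply]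
    rw [Finset.sum_comm]
    exact Finset.sum_congr rfl fun a _ => Finset.sum_congr rfl fun b _ => smul_comm _ _ _

/-- Adding left multiples of a wing row to the rows, after a permutation of the rows, preserves
the wing structure. -/
theorem WingStructure.rowOp {x : K} {e f : Fin k → Option ℕ}
    {L L' : Matrix (Fin k) (Fin k) 𝒜} {T : 𝒜} (h : WingStructure x 0 e f L T)
    (σ : Equiv.Perm (Fin k)) (w : Fin k) (hw : e w = none) (D : Fin k → 𝒜)
    (hL' : ∀ a b, L' a b = L (σ a) b + D a * L w b) :
    WingStructure x 0 (e ∘ σ) f L' T := by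
  have hrow : ∀ a, ∑ b, weight x (f b) • L' a b = ∑ b, weight x (f b) • L (σ a) b := by
    intro a
    have hz := h.row w (Nat.zero_le _) hw
    simp only [hL', smul_add, Finset.sum_add_distrib, ← mul_smul_comm]
    rw [← Finset.mul_sum, hz, mul_zero, add_zero]
  refine ⟨fun a _ ha => ?_, fun b _ hb => ?_, fun a b _ _ ha hb => ?_, ?_⟩
  · rw [hrow]
    exact h.row _ (Nat.zero_le _) ha
  · have hz := h.zero w b (Nat.zero_le _) (Nat.zero_le _) hw hb
    simp only [hL', hz, mul_zero, add_zero, Function.comp]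
    rw [Equiv.sum_comp σ (fun a => weight x (e a) • L a b)]
    exact h.col b (Nat.zero_le _) hb
  · rw [hL', h.zero _ b (Nat.zero_le _) (Nat.zero_le _) ha hb,
      h.zero w b (Nat.zero_le _) (Nat.zero_le _) hw hb, mul_zero, add_zero]
  · simp only [hrow, Function.comp]
    rw [Equiv.sum_comp σ (fun a => weight x (e a) • ∑ b, weight x (f b) • L a b)]
    exact h.total

/-- The diagonal of the constant term. -/
def constDiag (k : ℕ) (A : ℕ → 𝒜) (a : Fin k) : 𝒜 := if (a : ℕ) + 1 = k then -A 0 else 1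

/-- The product `M` of the elementary matrices with (shifted) indices in `{m : k - 1}` of a Fiedler
pencil: the rows and columns `m, …, k - 1` of `x M - M₀` have the wing structure for the truncated
polynomial, and row and column `m - 1` are those of a monic polynomial. -/
structure PartialFiedler (x : K) (A : ℕ → 𝒜) (m p q : ℕ) (e f : Fin k → Option ℕ)
    (M : Matrix (Fin k) (Fin k) 𝒜) : Prop where
  size : p + q + 1 + m = k
  level_row : IsLevel q e
  level_col : IsLevel p f
  supp_row : ∀ a : Fin k, (a : ℕ) < m → e a = none
  supp_col : ∀ a : Fin k, (a : ℕ) < m → f a = none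
  row_id : ∀ a b : Fin k, (a : ℕ) + 1 < m → M a b = if a = b then 1 else 0
  col_id : ∀ a b : Fin k, (b : ℕ) + 1 < m → M a b = if a = b then 1 else 0
  pivot : ∀ c : Fin k, (c : ℕ) + 1 = m → M c c = 0
  pivot_row_zero : ∀ c b : Fin k, (c : ℕ) + 1 = m → m ≤ b → f b = none → M c b = 0
  pivot_col_zero : ∀ c a : Fin k, (c : ℕ) + 1 = m → m ≤ a → e a = none → M a c = 0
  pivot_row_sum : ∀ c : Fin k, (c : ℕ) + 1 = m → ∑ b, weight x (f b) • M c b = x ^ p • 1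
  pivot_col_sum : ∀ c : Fin k, (c : ℕ) + 1 = m → ∑ a, weight x (e a) • M a c = x ^ q • 1
  wings : WingStructure x m e f (x • M - Matrix.diagonal (constDiag k A))
    (∑ s ∈ Finset.range (p + q + 2), x ^ s • A s)
  last : ∀ a : Fin k, (a : ℕ) + 1 = k → e a = some 0 ∧ f a = some 0 ∧ M a a = A 1

theorem PartialFiedler.transpose {x : K} {A : ℕ → 𝒜} {m p q : ℕ} {e f : Fin k → Option ℕ}
    {M : Matrix (Fin k) (Fin k) 𝒜} (h : PartialFiedler x A m p q e f M) (φ : 𝒜 →ₗ[K] ℬ)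
    (hφ : φ 1 = 1) :
    PartialFiedler x (fun s => φ (A s)) m q p f e (Mᵀ.map φ) where
  size := by have := h.size; omega
  level_row := h.level_col
  level_col := h.level_row
  supp_row := h.supp_col
  supp_col := h.supp_row
  row_id a b hab := by
    simp [h.col_id b a hab, apply_ite φ, hφ, eq_comm]
  col_id a b hab := by
    simp [h.row_id b a hab, apply_ite φ, hφ, eq_comm]
  pivot c hc := by simp [h.pivot c hc]
  pivot_row_zero c b hc hb hfb := by simp [h.pivot_col_zero c b hc hb hfb]
  pivot_col_zero c b hc hb hfb := by simp [h.pivot_row_zero c b hc hb hfb]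
  pivot_row_sum c hc := by simpa [hφ] using congrArg φ (h.pivot_col_sum c hc)
  pivot_col_sum c hc := by simpa [hφ] using congrArg φ (h.pivot_row_sum c hc)
  wings := by
    convert h.wings.transpose φ using 1
    · ext a b
      by_cases hab : a = b
      · subst hab
        simp [constDiag, apply_ite φ, hφ]
      · simp [Matrix.diagonal_apply_ne _ hab]
    · simp [add_comm p q]
  last a ha := by
    obtain ⟨h1, h2, h3⟩ := h.last a ha
    exact ⟨h2, h1, by simp [h3]⟩

/-- The old pivot row `m` moves up to row `m - 1`, and the new row `m` is the unit row `m - 1` plus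
`B` times the old pivot row. As a body row of level `q + 1` it adds `x ^ (q + 1) • x • B • x ^ p` to
the total. Column `m` becomes a wing column: its old weighted sum `x ^ (q + 1)` is cancelled by the
diagonal entry `-1` of `-M₀`. -/
theorem PartialFiedler.stepMatrix_mul {x : K} {A : ℕ → 𝒜} {m p q : ℕ} {e f : Fin k → Option ℕ}
    {M : Matrix (Fin k) (Fin k) 𝒜} (h : PartialFiedler x A (m + 1) p q e f M) (w : Fin k)
    (hw : (w : ℕ) = m) :
    PartialFiedler x A m p (q + 1) (Function.update e w (some (q + 1))) f
      (stepMatrix k (m : ℤ) (A (p + q + 2)) * M) := by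
  have hsize := h.size
  set B := A (p + q + 2) with hB
  set M' := stepMatrix k (m : ℤ) B * M with hM'
  have hew : e w = none := h.supp_row w (by omega)
  have hfw : f w = none := h.supp_col w (by omega)
  have r1 : ∀ a b : Fin k, (a : ℕ) ≠ m → (a : ℕ) + 1 ≠ m → M' a b = M a b := fun a b h1 h2 =>
    stepMatrix_mul_apply_of_ne (by omega) (by omega)
  have r2 : ∀ a b : Fin k, (a : ℕ) + 1 = m → M' a b = M w b := fun a b h1 =>
    stepMatrix_mul_apply_pred (by omega) (by omega)
  -- For `m = 0` there is no row above; the condition of the `if` is then never met, so one formula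
  -- covers both cases.
  have r3 : ∀ b : Fin k, M' w b = (if (b : ℕ) + 1 = m then 1 else 0) + B * M w b := by
    intro b
    rcases Nat.eq_zero_or_pos m with hm | hm
    · subst hm
      rw [if_neg (by omega), zero_add]
      exact stepMatrix_zero_mul_apply_self (by omega)
    · have hc : ((⟨m - 1, by omega⟩ : Fin k) : ℤ) + 1 = m := by
        simp only
        omega
      rw [hM', stepMatrix_mul_apply_self (by omega) hc, h.row_id _ _ (by simp only; omega)]
      congr 1
      simp only [Fin.ext_iff]
      congr 1
      rw [eq_iff_iff]
      omega
  have gt_of : ∀ a : Fin k, m ≤ a → a ≠ w → m + 1 ≤ a := by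
    intro a h1 h2
    have : (a : ℕ) ≠ w := fun h' => h2 (Fin.ext h')
    omega
  have hsum : ∀ g : Fin k → 𝒜, ∑ a, weight x (Function.update e w (some (q + 1)) a) • g a =
      ∑ a, weight x (e a) • g a + x ^ (q + 1) • g w := by
    intro g
    have : ∀ a, weight x (Function.update e w (some (q + 1)) a) • g a =
        weight x (e a) • g a + if a = w then x ^ (q + 1) • g a else 0 := by
      intro a
      by_cases ha : a = w
      · subst ha
        simp [hew]
      · simp [ha]
    simp only [this, Finset.sum_add_distrib, Finset.sum_ite_eq', Finset.mem_univ, if_true]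
  have hne : ∀ a, Function.update e w (some (q + 1)) a = none → a ≠ w ∧ e a = none := by
    intro a ha
    by_cases haw : a = w
    · subst haw
      simp at ha
    · exact ⟨haw, by rwa [Function.update_of_ne haw] at ha⟩
  have hbody : ∀ a : Fin k, m + 1 ≤ (a : ℕ) → ∀ b, M' a b = M a b := fun a ha b =>
    r1 a b (by omega) (by omega)
  -- The old weights vanish on the rows up to `m`, which are the only ones that the multiplication
  -- changes.
  have hcongr : ∀ g g' : Fin k → 𝒜, (∀ a : Fin k, m + 1 ≤ (a : ℕ) → g a = g' a) →
      ∑ a, weight x (e a) • g a = ∑ a, weight x (e a) • g' a := by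
    intro g g' hg
    refine Finset.sum_congr rfl fun a _ => ?_
    by_cases ha : m + 1 ≤ (a : ℕ)
    · rw [hg a ha]
    · rw [h.supp_row a (by omega)]
      simp
  refine
    { size := by omega
      level_row := h.level_row.update hew
      level_col := h.level_col
      supp_row := fun a ha => ?_
      supp_col := fun a ha => h.supp_col a (by omega)
      row_id := fun a b ha => ?_
      col_id := fun a b hb => ?_
      pivot := fun c hc => ?_
      pivot_row_zero := fun c b hc hb hfb => ?_
      pivot_col_zero := fun c a hc ha hea => ?_
      pivot_row_sum := fun c hc => ?_
      pivot_col_sum := fun c hc => ?_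
      wings := ⟨fun a ha hea => ?_, fun b hb hfb => ?_, fun a b ha hb hea hfb => ?_, ?_⟩
      last := fun a ha => ?_ }
  · have : a ≠ w := by rintro rfl; omega
    rw [Function.update_of_ne this]
    exact h.supp_row a (by omega)
  · rw [r1 a b (by omega) (by omega)]
    exact h.row_id a b (by omega)
  · have hwb : w ≠ b := by rintro rfl; omega
    have h0 := h.col_id w b (by omega)
    rw [if_neg hwb] at h0
    by_cases haw : a = w
    · subst haw
      rw [r3, h0, if_neg (by omega), if_neg hwb, mul_zero, add_zero]
    · have : (a : ℕ) ≠ m := fun h' => haw (Fin.ext (by omega))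
      by_cases ham : (a : ℕ) + 1 = m
      · rw [r2 a b ham, h0, if_neg]
        rintro rfl
        omega
      · rw [r1 a b this ham]
        exact h.col_id a b (by omega)
  · rw [r2 c c hc, h.col_id w c (by omega), if_neg]
    rintro rfl
    omega
  · rw [r2 c b hc]
    by_cases hbw : b = w
    · subst hbw
      exact h.pivot _ (by omega)
    · exact h.pivot_row_zero w b (by omega) (gt_of b hb hbw) hfb
  · obtain ⟨haw, hea⟩ := hne a hea
    rw [hbody a (gt_of a ha haw), h.col_id a c (by omega), if_neg]
    rintro rfl
    omega
  · simp only [r2 c _ hc]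
    exact h.pivot_row_sum w (by omega)
  · have hwc : w ≠ c := by rintro rfl; omega
    rw [hsum, hcongr _ (fun _ => 0), r3, if_pos hc, h.col_id w c (by omega), if_neg hwc]
    · simp
    · intro a ha
      rw [hbody a ha, h.col_id a c (by omega), if_neg]
      rintro rfl
      omega
  · obtain ⟨haw, hea⟩ := hne a hea
    have := h.wings.row a (gt_of a ha haw) hea
    simpa only [Matrix.sub_apply, Matrix.smul_apply, hbody a (gt_of a ha haw)] using this
  · rw [hsum, hcongr _ (fun a => (x • M - Matrix.diagonal (constDiag k A)) a b)]
    · by_cases hbw : b = w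
      · subst hbw
        -- The diagonal part drops out, because row `b` has weight `0` before the step; what remains
        -- is `x` times the pivot column sum.
        have h1 : ∑ a, weight x (e a) • (x • M - Matrix.diagonal (constDiag k A)) a b =
            x ^ (q + 1) • 1 := by
          have h2 : ∀ a, weight x (e a) • (x • M - Matrix.diagonal (constDiag k A)) a b =
              x • (weight x (e a) • M a b) := by
            intro a
            by_cases hab : a = b
            · subst hab
              simp [hew]
            · simp [Matrix.diagonal_apply_ne _ hab, smul_comm x]
          simp only [h2]
          rw [← Finset.smul_sum, h.pivot_col_sum b (by omega), smul_smul, pow_succ']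
        rw [h1]
        simp only [Matrix.sub_apply, Matrix.smul_apply, r3, h.pivot b (by omega),
          Matrix.diagonal_apply_eq, constDiag]
        rw [if_neg (by omega), if_neg (by omega)]
        simp
      · have hb' := gt_of b hb hbw
        rw [h.wings.col b hb' hfb]
        simp only [Matrix.sub_apply, Matrix.smul_apply, r3,
          h.pivot_row_zero w b (by omega) hb' hfb, Matrix.diagonal_apply_ne _ (Ne.symm hbw)]
        rw [if_neg (by omega)]
        simp
    · intro a ha
      simp only [Matrix.sub_apply, Matrix.smul_apply, hbody a ha]
  · obtain ⟨haw, hea⟩ := hne a hea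
    have ha' := gt_of a ha haw
    by_cases hbw : b = w
    · subst hbw
      simp only [Matrix.sub_apply, Matrix.smul_apply, hbody a ha',
        h.pivot_col_zero b a (by omega) ha' ‹_›, Matrix.diagonal_apply_ne _ haw]
      simp
    · have := h.wings.zero a b ha' (gt_of b hb hbw) hea hfb
      simpa only [Matrix.sub_apply, Matrix.smul_apply, hbody a ha'] using this
  · rw [hsum, hcongr _
      (fun a => ∑ b, weight x (f b) • (x • M - Matrix.diagonal (constDiag k A)) a b),
      h.wings.total, show p + (q + 1) + 2 = (p + q + 2) + 1 by ring,
      Finset.sum_range_succ _ (p + q + 2)]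
    · congr 1
      have h2 : ∀ b, weight x (f b) • (x • M' - Matrix.diagonal (constDiag k A)) w b =
          (x • B) * (weight x (f b) • M w b) := by
        intro b
        by_cases hb : m ≤ (b : ℕ)
        · by_cases hbw : b = w
          · subst hbw
            simp [hfw]
          · simp only [Matrix.sub_apply, Matrix.smul_apply, r3,
              Matrix.diagonal_apply_ne _ (Ne.symm hbw), if_neg (show ¬((b : ℕ) + 1 = m) by omega)]
            simp
        · rw [h.supp_col b (by omega)]
          simp
      simp only [h2]
      rw [← Finset.mul_sum, h.pivot_row_sum w (by omega), mul_smul_comm, mul_one, smul_smul,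
        smul_smul, ← pow_add, ← pow_succ]
      congr 2
      omega
    · intro a ha
      simp only [Matrix.sub_apply, Matrix.smul_apply, hbody a ha]
  · obtain ⟨h1, h2, h3⟩ := h.last a ha
    have : a ≠ w := by rintro rfl; omega
    exact ⟨by rwa [Function.update_of_ne this], h2, by rw [hbody a (by omega), h3]⟩

/-- Transposing into `𝒜ᵐᵒᵖ` and back turns the right factor into a left one. -/
theorem PartialFiedler.mul_stepMatrix {x : K} {A : ℕ → 𝒜} {m p q : ℕ} {e f : Fin k → Option ℕ}
    {M : Matrix (Fin k) (Fin k) 𝒜} (h : PartialFiedler x A (m + 1) p q e f M) (w : Fin k)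
    (hw : (w : ℕ) = m) :
    PartialFiedler x A m (p + 1) q e (Function.update f w (some (p + 1)))
      (M * stepMatrix k (m : ℤ) (A (p + q + 2))) := by
  have h1 := (h.transpose (opLinearEquiv K : 𝒜 ≃ₗ[K] 𝒜ᵐᵒᵖ).toLinearMap (by simp)).stepMatrix_mul
    w hw
  have h2 := h1.transpose (opLinearEquiv K : 𝒜 ≃ₗ[K] 𝒜ᵐᵒᵖ).symm.toLinearMap (by simp)
  convert h2 using 1
  · rfl
  refine Matrix.ext fun a b => ?_
  have h3 := congrFun (congrFun (opTranspose_mul M (stepMatrix k (m : ℤ) (A (p + q + 2)))) b) a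
  rw [opTranspose_stepMatrix] at h3
  rw [add_comm q p]
  exact congrArg unop h3

theorem partialFiedler_last (x : K) (A : ℕ → 𝒜) {m : ℕ} (hm : m + 1 = k) :
    PartialFiedler x A m 0 0 (fun a : Fin k => if (a : ℕ) = m then some 0 else none)
      (fun a : Fin k => if (a : ℕ) = m then some 0 else none) (stepMatrix k (m : ℤ) (A 1)) := by
  have hlev : IsLevel 0 (fun a : Fin k => if (a : ℕ) = m then some 0 else none) := by
    refine ⟨fun a d h => ?_, fun a b d ha hb => ?_, fun d hd => ⟨⟨m, by omega⟩, ?_⟩⟩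
    · split_ifs at h
      simp_all
    · split_ifs at ha hb
      exact Fin.ext (by omega)
    · simp
      omega
  have hsum : ∀ (w : Fin k), (w : ℕ) = m → ∀ g : Fin k → 𝒜,
      ∑ a : Fin k, weight x (if (a : ℕ) = m then some 0 else none) • g a = g w := by
    intro w hw g
    rw [Finset.sum_eq_single w]
    · simp [hw]
    · intro a _ ha
      have : (a : ℕ) ≠ m := fun h => ha (Fin.ext (by omega))
      simp [this]
    · simp
  have hlast : ∀ a : Fin k, m ≤ a → (a : ℕ) = m := fun a ha => by omega
  have hw : ((⟨m, by omega⟩ : Fin k) : ℕ) = m := rfl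
  have hpp : ∀ a b : Fin k, (a : ℕ) + 1 = m → (b : ℕ) = m →
      stepMatrix k (m : ℤ) (A 1) a b = 1 ∧ stepMatrix k (m : ℤ) (A 1) b a = 1 := by
    intro a b h1 h2
    have h3 : ((a : ℤ) + 1 = m) := by omega
    simp [stepMatrix, h3, h2]
  have hll : ∀ b : Fin k, (b : ℕ) = m → stepMatrix k (m : ℤ) (A 1) b b = A 1 := by
    intro b h2
    simp [stepMatrix, h2]
  have hid : ∀ a b : Fin k, ((a : ℕ) + 1 < m ∨ (b : ℕ) + 1 < m) →
      stepMatrix k (m : ℤ) (A 1) a b = if a = b then 1 else 0 := by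
    intro a b hab
    have h1 := stepMatrix_sub_one_apply_eq_zero (j := (m : ℤ)) (B := A 1) (a := a) (b := b)
      (by omega)
    rw [Matrix.sub_apply, sub_eq_zero] at h1
    rw [h1, Matrix.one_apply]
  refine
    { size := by omega
      level_row := hlev
      level_col := hlev
      supp_row := fun a ha => if_neg (by omega)
      supp_col := fun a ha => if_neg (by omega)
      row_id := fun a b ha => hid a b (Or.inl ha)
      col_id := fun a b ha => hid a b (Or.inr ha)
      pivot := fun c hc => ?_
      pivot_row_zero := fun c b hc hb hfb => ?_
      pivot_col_zero := fun c a hc ha hea => ?_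
      pivot_row_sum := fun c hc => ?_
      pivot_col_sum := fun c hc => ?_
      wings := ⟨fun a ha hea => ?_, fun b hb hfb => ?_, fun a b ha hb hea hfb => ?_, ?_⟩
      last := fun a ha => ?_ }
  · have h1 : (c : ℤ) + 1 = m := by omega
    have h2 : (c : ℕ) ≠ m := by omega
    simp [stepMatrix, h1, h2]
  · simp [hlast b hb] at hfb
  · simp [hlast a ha] at hea
  · rw [hsum _ hw, (hpp c _ hc hw).1]
    simp
  · rw [hsum _ hw, (hpp c _ hc hw).2]
    simp
  · simp [hlast a ha] at hea
  · simp [hlast b hb] at hfb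
  · simp [hlast a ha] at hea
  · rw [hsum _ hw, hsum _ hw]
    simp [hll _ hw, constDiag, hm, Finset.sum_range_succ, add_comm]
  · have : (a : ℕ) = m := by omega
    simp [this, hll a this]

end BlockOperations

/-! ### Index tuples: the SIP, equivalence, and heads -/

section Tuples

/-- The first occurrence of `j + 1` precedes all occurrences of `j`. -/
def SuccFirst (t : List ℤ) (j : ℤ) : Prop := t.idxOf (j + 1) < t.idxOf j

/-- With its converse `sip_of_succ_mem` this replaces positions by list decompositions, which makes
the passage to infixes, reversals and shifts immediate. -/
theorem SIP.succ_mem {t u v w : List ℤ} {x : ℤ} (h : SIP t)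
    (ht : t = u ++ x :: (v ++ x :: w)) : x + 1 ∈ v := by
  subst ht
  obtain ⟨c, h1, h2, h3⟩ := h ⟨u.length, by simp⟩
    ⟨u.length + (1 + v.length), by simp; omega⟩ (by simp)
    (by simp [List.getElem_append_right, add_comm 1])
  obtain ⟨c, hc⟩ := c
  simp only [Fin.mk_lt_mk] at h1 h2
  obtain ⟨d, rfl⟩ := Nat.exists_eq_add_of_lt h1
  have hd : d < v.length := by omega
  have h4 : v[d] = x + 1 := by
    simpa [List.getElem_append_right, List.getElem_append_left, hd, add_assoc] using h3
  exact h4 ▸ List.getElem_mem hd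

theorem sip_of_succ_mem {t : List ℤ}
    (h : ∀ (u v w : List ℤ) (x : ℤ), t = u ++ x :: (v ++ x :: w) → x + 1 ∈ v) : SIP t := by
  intro a b hab hx
  have hab' : (a : ℕ) < b := hab
  have hb := b.2
  have hdrop : t.drop a = t.get a :: t.drop (a + 1) := List.drop_eq_getElem_cons a.2
  have hdrop2 : t.drop b = t.get b :: t.drop (b + 1) := List.drop_eq_getElem_cons b.2
  have key : t = t.take a ++ t.get a :: ((t.drop (a + 1)).take (b - (a + 1)) ++
      t.get a :: t.drop (b + 1)) := by
    conv_lhs => rw [← List.take_append_drop a t, hdrop,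
      ← List.take_append_drop (b - (a + 1)) (t.drop (a + 1)), List.drop_drop]
    rw [show (a : ℕ) + 1 + (b - (a + 1)) = b by omega, hdrop2, hx]
  obtain ⟨i, hi, hi'⟩ := List.getElem_of_mem (h _ _ _ _ key)
  simp only [List.length_take, List.length_drop] at hi
  refine ⟨⟨a + 1 + i, by omega⟩, ?_, ?_, ?_⟩
  · simp [Fin.lt_def]
    omega
  · simp [Fin.lt_def]
    omega
  · simpa using hi'

theorem SIP.infix {t u v : List ℤ} (h : SIP (u ++ t ++ v)) : SIP t :=
  sip_of_succ_mem fun a b c x ht => h.succ_mem (u := u ++ a) (w := c ++ v) (by simp [ht])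

theorem SIP.reverse {t : List ℤ} (h : SIP t) : SIP t.reverse :=
  sip_of_succ_mem fun a b c x ht => by
    have := h.succ_mem (u := c.reverse) (v := b.reverse) (w := a.reverse) (x := x)
      (by rw [← List.reverse_reverse t, ht]; simp)
    simpa using this

theorem SIP.shift {t : List ℤ} (h : SIP t) (i : ℤ) : SIP (shift i t) :=
  sip_of_succ_mem fun a b c x ht => by
    have h1 : t = (GFPR.shift i t).map (fun y => y - i) := by
      simp [GFPR.shift, Function.comp_def]
    rw [ht] at h1
    obtain ⟨y, hy, hyx⟩ := List.mem_map.1 (h.succ_mem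
      (u := a.map (fun y => y - i)) (v := b.map (fun y => y - i)) (w := c.map (fun y => y - i))
      (x := x - i) (by simpa using h1))
    rwa [show x + 1 = y by linarith]

theorem SIP.succFirst {x : ℤ} {t : List ℤ} (h : SIP (x :: t)) (hx : x ∈ t) : SuccFirst t x := by
  obtain ⟨u, v, rfl, hu⟩ := List.eq_append_cons_of_mem hx
  have h1 : x + 1 ∈ u := h.succ_mem (u := []) rfl
  have := List.idxOf_lt_length_of_mem h1
  simp [SuccFirst, List.idxOf_append, h1, hu]
  omega

theorem succFirst_append_cons_iff {u v : List ℤ} {j : ℤ} (hu : j ∉ u) :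
    SuccFirst (u ++ j :: v) j ↔ j + 1 ∈ u := by
  rw [SuccFirst, List.idxOf_append_of_notMem hu, List.idxOf_cons_self, add_zero]
  by_cases h : j + 1 ∈ u
  · simp [h, List.idxOf_append_of_mem h, List.idxOf_lt_length_of_mem h]
  · simp [h, List.idxOf_append_of_notMem h]

theorem succFirst_reverse_iff {t : List ℤ} (ht : t.Nodup) {j : ℤ} (h1 : j ∈ t) (h2 : j + 1 ∈ t) :
    SuccFirst t.reverse j ↔ ¬SuccFirst t j := by
  obtain ⟨u, v, rfl, hu⟩ := List.eq_append_cons_of_mem h1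
  have hv : j ∉ v := by
    have := List.nodup_append.1 ht
    exact (List.nodup_cons.1 this.2.1).1
  rw [succFirst_append_cons_iff hu, show (u ++ j :: v).reverse = v.reverse ++ j :: u.reverse by simp,
    succFirst_append_cons_iff (by simpa using hv), List.mem_reverse]
  have hd : j + 1 ∈ u → j + 1 ∉ v := fun ha hb =>
    (List.nodup_append.1 ht).2.2 _ ha _ (List.mem_cons_of_mem _ hb) rfl
  simp at h2
  tauto

theorem TupleEquiv.trans {s t u : List ℤ} (h1 : TupleEquiv s t) (h2 : TupleEquiv t u) :
    TupleEquiv s u :=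
  Relation.ReflTransGen.trans h1 h2

theorem TupleEquiv.append {s t : List ℤ} (h : TupleEquiv s t) (u v : List ℤ) :
    TupleEquiv (u ++ s ++ v) (u ++ t ++ v) := by
  refine Relation.ReflTransGen.lift (p := CommSwap) (fun s => u ++ s ++ v) ?_ s t h
  rintro _ _ ⟨a, b, x, y, h1, h2, rfl, rfl⟩
  exact ⟨u ++ a, b ++ v, x, y, h1, h2, by simp, by simp⟩

theorem TupleEquiv.perm {s t : List ℤ} (h : TupleEquiv s t) : s.Perm t := by
  induction h with
  | refl => exact List.Perm.refl _
  | tail _ h2 ih =>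
    obtain ⟨a, b, x, y, -, -, rfl, rfl⟩ := h2
    exact ih.trans (List.Perm.append_left a (List.Perm.swap y x b))

/-- An admissible interchange never involves both `j` and `j + 1`, so the order of their first
occurrences is invariant. Thus heads can be read off the original tuple. -/
theorem TupleEquiv.succFirst_iff {s t : List ℤ} (h : TupleEquiv s t) (j : ℤ) :
    SuccFirst s j ↔ SuccFirst t j := by
  induction h with
  | refl => rfl
  | tail _ h2 ih =>
    obtain ⟨a, b, x, y, hxy, hxy', rfl, rfl⟩ := h2
    rw [ih]
    have h1 : x ≠ y + 1 := by rintro rfl; simp at hxy'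
    have h2 : y ≠ x + 1 := by rintro rfl; simp at hxy'
    have h3 : ∀ i, i ∉ a ∨ i ∈ a ∧ a.idxOf i < a.length := fun i =>
      (em (i ∈ a)).symm.imp_right fun h => ⟨h, List.idxOf_lt_length_of_mem h⟩
    simp only [SuccFirst, List.idxOf_append, List.idxOf_cons, cond_eq_ite, beq_iff_eq]
    rcases h3 j with h4 | ⟨h4, h5⟩ <;> rcases h3 (j + 1) with h6 | ⟨h6, h7⟩ <;>
      simp only [h4, h6, if_true, if_false] <;> split_ifs <;> omega

theorem tupleEquiv_cons_append {x : ℤ} {v : List ℤ} (h : ∀ y ∈ v, x + 2 ≤ y ∨ y + 2 ≤ x) :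
    TupleEquiv (x :: v) (v ++ [x]) := by
  induction v with
  | nil => exact Relation.ReflTransGen.refl
  | cons y v ih =>
    have hy := h y List.mem_cons_self
    refine TupleEquiv.trans (t := y :: x :: v) (Relation.ReflTransGen.single
      ⟨[], v, x, y, by omega, ?_, rfl, rfl⟩) ?_
    · intro h1
      rcases abs_eq (by norm_num : (0 : ℤ) ≤ 1) |>.1 h1 with h1 | h1 <;> omega
    · simpa using (ih fun z hz => h z (List.mem_cons_of_mem _ hz)).append [y] []

theorem commSwap_symm {s t : List ℤ} (h : CommSwap s t) : CommSwap t s := by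
  obtain ⟨a, b, x, y, h1, h2, rfl, rfl⟩ := h
  exact ⟨a, b, y, x, h1.symm, by rwa [abs_sub_comm], rfl, rfl⟩

theorem TupleEquiv.symm {s t : List ℤ} (h : TupleEquiv s t) : TupleEquiv t s :=
  have : Std.Symm CommSwap := ⟨fun _ _ => commSwap_symm⟩
  Relation.ReflTransGen.stdSymm.symm _ _ h

theorem string_eq_map (a b : ℤ) :
    string a b = (List.range (b + 1 - a).toNat).map (fun i : ℕ => a + (i : ℤ)) := by
  simp [string, List.map_eq_flatMap, List.flatMap_assoc]

theorem mem_string {a b x : ℤ} : x ∈ string a b ↔ a ≤ x ∧ x ≤ b := by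
  simp only [string_eq_map, List.mem_map, List.mem_range]
  constructor
  · rintro ⟨i, hi, rfl⟩
    omega
  · rintro ⟨h1, h2⟩
    exact ⟨(x - a).toNat, by omega, by omega⟩

theorem string_append_string {a b c : ℤ} (h1 : a ≤ b + 1) (h2 : b ≤ c) :
    string a b ++ string (b + 1) c = string a c := by
  simp only [string_eq_map]
  rw [show (c + 1 - a).toNat = (b + 1 - a).toNat + (c + 1 - (b + 1)).toNat by omega,
    List.range_add, List.map_append, List.map_map]
  congr 1
  refine List.map_congr_left fun i _ => ?_
  simp only [Function.comp]
  push_cast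
  rw [Int.toNat_of_nonneg (by omega)]
  ring

theorem string_self (a : ℤ) : string a a = [a] := by
  simp [string_eq_map]

theorem mem_concatStrings {S : List (ℤ × ℤ)} {x : ℤ} :
    x ∈ concatStrings S ↔ ∃ ab ∈ S, ab.1 ≤ x ∧ x ≤ ab.2 := by
  simp [concatStrings, mem_string]

/-- Every permutation of `{0 : n - 1}` is equivalent to a tuple in column standard form. -/
theorem exists_columnStandard {t : List ℤ} (ht : t.Nodup) {k : ℕ}
    (hk : ∀ i : ℤ, i ∈ t ↔ 0 ≤ i ∧ i < k) (n : ℕ) (hn : n ≤ k) :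
    ∃ S : List (ℤ × ℤ), IsColumnStandard S ∧ (∀ ab ∈ S, ab.2 < n) ∧
      TupleEquiv (t.filter (· < (n : ℤ))) (concatStrings S) ∧
      (0 < n → ∃ a S', S = (a, (n : ℤ) - 1) :: S') := by
  induction n with
  | zero =>
    refine ⟨[], ⟨by simp, by simp⟩, by simp, ?_, by simp⟩
    have : t.filter (· < ((0 : ℕ) : ℤ)) = [] := by
      rw [List.filter_eq_nil_iff]
      intro a ha
      have := (hk a).1 ha
      simp
      omega
    rw [this]
    exact Relation.ReflTransGen.refl
  | succ n ih =>
    obtain ⟨S, ⟨hS1, hS2⟩, hSn, hequiv, hhead⟩ := ih (by omega)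
    obtain ⟨u, v, rfl, hu⟩ := List.eq_append_cons_of_mem ((hk n).2 (by omega))
    have hv : (n : ℤ) ∉ v := (List.nodup_cons.1 (List.nodup_append.1 ht).2.1).1
    have hfilter : ∀ w : List ℤ, (n : ℤ) ∉ w →
        w.filter (· < ((n + 1 : ℕ) : ℤ)) = w.filter (· < (n : ℤ)) := by
      intro w hw
      refine List.filter_congr fun a ha => ?_
      have : a ≠ n := fun h => hw (h ▸ ha)
      simp
      omega
    have h1 : (u ++ (n : ℤ) :: v).filter (· < ((n + 1 : ℕ) : ℤ)) =
        u.filter (· < (n : ℤ)) ++ (n : ℤ) :: v.filter (· < (n : ℤ)) := by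
      rw [List.filter_append, List.filter_cons_of_pos (by simp), hfilter u hu, hfilter v hv]
    have h2 : (u ++ (n : ℤ) :: v).filter (· < (n : ℤ)) =
        u.filter (· < (n : ℤ)) ++ v.filter (· < (n : ℤ)) := by
      rw [List.filter_append, List.filter_cons_of_neg (by simp)]
    rw [h2] at hequiv
    rw [h1]
    -- If `n - 1` precedes `n`, then `n` can be moved to the right and back to the end of the
    -- leading string, which ends in `n - 1`. Otherwise `n` can be moved to the front as a string of
    -- its own.
    by_cases hpu : (n : ℤ) - 1 ∈ u
    · have hpv : (n : ℤ) - 1 ∉ v := fun h =>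
        (List.nodup_append.1 ht).2.2 _ hpu _ (List.mem_cons_of_mem _ h) rfl
      have hpos : 0 < n := by
        have := (hk (n - 1)).1 (by simp [hpu])
        omega
      obtain ⟨a, S', rfl⟩ := hhead hpos
      have ha := hS1 _ List.mem_cons_self
      simp only at ha
      rw [List.pairwise_cons] at hS2
      refine ⟨(a, n) :: S', ⟨?_, ?_⟩, ?_, ?_, fun _ => ⟨a, S', by simp⟩⟩
      · intro ab hab
        rcases List.mem_cons.1 hab with rfl | hab
        · simp only
          omega
        · exact hS1 _ (List.mem_cons_of_mem _ hab)
      · refine List.pairwise_cons.2 ⟨fun ab hab => ?_, hS2.2⟩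
        have := hS2.1 ab hab
        simp only at this ⊢
        omega
      · intro ab hab
        rcases List.mem_cons.1 hab with rfl | hab
        · push_cast
          omega
        · have := hSn _ (List.mem_cons_of_mem _ hab)
          push_cast
          omega
      · have e1 : TupleEquiv ((n : ℤ) :: v.filter (· < (n : ℤ)))
            (v.filter (· < (n : ℤ)) ++ [(n : ℤ)]) := by
          refine tupleEquiv_cons_append fun y hy => ?_
          simp only [List.mem_filter, decide_eq_true_eq] at hy
          have : y ≠ (n : ℤ) - 1 := fun h => hpv (h ▸ hy.1)
          omega
        have e2 : TupleEquiv (concatStrings S' ++ [(n : ℤ)]) ((n : ℤ) :: concatStrings S') := by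
          refine (tupleEquiv_cons_append fun y hy => ?_).symm
          obtain ⟨ab, hab, hy1, hy2⟩ := mem_concatStrings.1 hy
          have := hS2.1 ab hab
          simp only at this
          omega
        have e3 := (e1.append (u.filter (· < (n : ℤ))) []).trans
          (by simpa using hequiv.append [] [(n : ℤ)])
        have e4 := e3.trans (by simpa [concatStrings] using e2.append (string a ((n : ℤ) - 1)) [])
        have e5 := string_append_string (a := a) (b := (n : ℤ) - 1) (c := n) (by omega) (by omega)
        rw [sub_add_cancel, string_self] at e5
        simpa [concatStrings, ← e5] using e4
    · refine ⟨((n : ℤ), (n : ℤ)) :: S, ⟨?_, ?_⟩, ?_, ?_, fun _ => ⟨n, S, by simp⟩⟩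
      · intro ab hab
        rcases List.mem_cons.1 hab with rfl | hab
        · simp
        · exact hS1 _ hab
      · exact List.pairwise_cons.2 ⟨hSn, hS2⟩
      · intro ab hab
        rcases List.mem_cons.1 hab with rfl | hab
        · simp
        · have := hSn _ hab
          push_cast
          omega
      · have e1 : TupleEquiv (u.filter (· < (n : ℤ)) ++ [(n : ℤ)])
            ((n : ℤ) :: u.filter (· < (n : ℤ))) := by
          refine (tupleEquiv_cons_append fun y hy => ?_).symm
          simp only [List.mem_filter, decide_eq_true_eq] at hy
          have : y ≠ (n : ℤ) - 1 := fun h => hpu (h ▸ hy.1)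
          omega
        have e2 := (e1.append [] (v.filter (· < (n : ℤ)))).trans
          (by simpa using hequiv.append [(n : ℤ)] [])
        simpa [concatStrings, string_self] using e2

/-- In a column standard form, all strings to the right of the one ending in `b` have smaller ends,
so `b + 1` can only occur to the left of `b`. A non-final element of a string, by contrast, is
followed by its successor. The argument applies to every column standard form of `t`, hence
uniqueness of the form plays no role. -/
theorem heads_eq {t : List ℤ} (ht : t.Nodup) {k : ℕ} (hk : ∀ i : ℤ, i ∈ t ↔ 0 ≤ i ∧ i < k) :
    heads t = {b | b ∈ t ∧ (b + 1 ∈ t → SuccFirst t b)} := by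
  ext b
  constructor
  · rintro ⟨S, ⟨hS1, hS2⟩, hequiv, a, hab⟩
    have hmem : ∀ x, x ∈ t ↔ x ∈ concatStrings S := fun x => hequiv.perm.mem_iff
    refine ⟨(hmem b).2 (mem_concatStrings.2 ⟨(a, b), hab, (hS1 _ hab).2, le_rfl⟩), fun hb => ?_⟩
    rw [hequiv.succFirst_iff]
    rw [hmem] at hb
    have hnd := hequiv.perm.nodup_iff.1 ht
    obtain ⟨S1, S2, rfl⟩ := List.append_of_mem hab
    have hle := (hS1 _ hab).2
    simp only at hle
    have hsplit : concatStrings (S1 ++ (a, b) :: S2) =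
        (concatStrings S1 ++ string a (b - 1)) ++ b :: concatStrings S2 := by
      have := string_append_string (a := a) (b := b - 1) (c := b) (by omega) (by omega)
      rw [sub_add_cancel, string_self] at this
      simp [concatStrings, ← this]
    rw [hsplit] at hb hnd ⊢
    have hbn : b ∉ concatStrings S1 ++ string a (b - 1) := fun h =>
      (List.nodup_append.1 hnd).2.2 _ h _ List.mem_cons_self rfl
    rw [succFirst_append_cons_iff hbn]
    rcases List.mem_append.1 hb with hb | hb
    · exact hb
    · rcases List.mem_cons.1 hb with hb | hb
      · omega
      · obtain ⟨cd, hcd, h1, h2⟩ := mem_concatStrings.1 hb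
        have := (List.pairwise_cons.1 (List.pairwise_append.1 hS2).2.1).1 cd hcd
        simp only at this
        omega
  · rintro ⟨hb, hbs⟩
    obtain ⟨S, hS, -, hequiv, -⟩ := exists_columnStandard ht hk k le_rfl
    rw [List.filter_eq_self.2 (fun a ha => by simpa using ((hk a).1 ha).2)] at hequiv
    refine ⟨S, hS, hequiv, ?_⟩
    have hmem : ∀ x, x ∈ t ↔ x ∈ concatStrings S := fun x => hequiv.perm.mem_iff
    obtain ⟨⟨c, d⟩, hcd, h1, h2⟩ := mem_concatStrings.1 ((hmem b).1 hb)
    simp only at h1 h2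
    rcases h2.eq_or_lt with rfl | h2
    · exact ⟨c, hcd⟩
    exfalso
    have hb1 : b + 1 ∈ t := (hmem _).2 (mem_concatStrings.2 ⟨(c, d), hcd, by simp; omega, by simp; omega⟩)
    have h3 := (hequiv.succFirst_iff b).1 (hbs hb1)
    have hnd := hequiv.perm.nodup_iff.1 ht
    obtain ⟨S1, S2, rfl⟩ := List.append_of_mem hcd
    have hsplit : concatStrings (S1 ++ (c, d) :: S2) =
        (concatStrings S1 ++ string c (b - 1)) ++
          b :: (string (b + 1) d ++ concatStrings S2) := by
      have e1 := string_append_string (a := c) (b := b - 1) (c := b) (by omega) (by omega)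
      have e2 := string_append_string (a := c) (b := b) (c := d) (by omega) (by omega)
      rw [sub_add_cancel, string_self] at e1
      simp [concatStrings, ← e2, ← e1]
    rw [hsplit] at h3 hnd
    have hdisj := (List.nodup_append.1 hnd).2.2
    rw [succFirst_append_cons_iff fun h => hdisj _ h _ List.mem_cons_self rfl] at h3
    refine hdisj _ h3 _ (List.mem_cons_of_mem _ (List.mem_append_left _ (mem_string.2 ?_))) rfl
    omega

open Classical in
theorem numHeads_eq {t : List ℤ} (ht : t.Nodup) {k : ℕ} (hk : ∀ i : ℤ, i ∈ t ↔ 0 ≤ i ∧ i < k)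
    (hpos : 0 < k) :
    numHeads t = ((Finset.Ico 0 (k - 1)).filter (fun j : ℕ => SuccFirst t j)).card + 1 := by
  have h : heads t = ((insert (k - 1)
      ((Finset.Ico 0 (k - 1)).filter (fun j : ℕ => SuccFirst t j))).image
        (fun j : ℕ => (j : ℤ)) : Finset ℤ) := by
    rw [heads_eq ht hk]
    ext b
    simp only [hk, Set.mem_ofPred_eq, Finset.coe_image, Finset.coe_insert, Set.mem_image,
      Set.mem_insert_iff, Finset.mem_coe, Finset.mem_filter, Finset.mem_Ico]
    constructor
    · rintro ⟨h1, h2⟩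
      refine ⟨b.toNat, ?_, by omega⟩
      by_cases hb : b + 1 < k
      · right
        rw [Int.toNat_of_nonneg h1.1]
        exact ⟨by omega, h2 (by omega)⟩
      · left
        omega
    · rintro ⟨j, h1 | ⟨h1, h2⟩, rfl⟩
      · exact ⟨by omega, fun h => by omega⟩
      · exact ⟨by omega, fun _ => h2⟩
  rw [numHeads, h, Set.ncard_coe_finset, Finset.card_image_of_injective _ Nat.cast_injective,
    Finset.card_insert_of_notMem (by simp)]

/-- In a product of pairwise commuting-if-distant factors, the factor of the smallest index can be
moved to one of the ends. -/
theorem prod_filter_le_of_succFirst {R : Type*} [Monoid R] {g : ℤ → R}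
    (hg : ∀ i j, i + 2 ≤ j → Commute (g i) (g j)) {t : List ℤ} (ht : t.Nodup) {m : ℤ} (hm : m ∈ t) :
    (SuccFirst t m → ((t.filter (m ≤ ·)).map g).prod =
      ((t.filter (m + 1 ≤ ·)).map g).prod * g m) ∧
    (¬SuccFirst t m → ((t.filter (m ≤ ·)).map g).prod =
      g m * ((t.filter (m + 1 ≤ ·)).map g).prod) := by
  obtain ⟨u, v, rfl, hu⟩ := List.eq_append_cons_of_mem hm
  have hv : m ∉ v := (List.nodup_cons.1 (List.nodup_append.1 ht).2.1).1
  have hfilter : ∀ w : List ℤ, m ∉ w → w.filter (m ≤ ·) = w.filter (m + 1 ≤ ·) := by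
    intro w hw
    refine List.filter_congr fun a ha => ?_
    have : a ≠ m := fun h => hw (h ▸ ha)
    simp
    omega
  have hcomm : ∀ w : List ℤ, m + 1 ∉ w →
      Commute (g m) ((w.filter (m + 1 ≤ ·)).map g).prod := by
    intro w hw
    refine Commute.list_prod_right _ _ fun y hy => ?_
    obtain ⟨a, ha, rfl⟩ := List.mem_map.1 hy
    simp only [List.mem_filter, decide_eq_true_eq] at ha
    have : a ≠ m + 1 := fun h => hw (h ▸ ha.1)
    exact hg _ _ (by omega)
  have h1 : (u ++ m :: v).filter (m ≤ ·) =
      u.filter (m + 1 ≤ ·) ++ m :: v.filter (m + 1 ≤ ·) := by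
    rw [List.filter_append, List.filter_cons_of_pos (by simp), hfilter u hu, hfilter v hv]
  have h2 : (u ++ m :: v).filter (m + 1 ≤ ·) =
      u.filter (m + 1 ≤ ·) ++ v.filter (m + 1 ≤ ·) := by
    rw [List.filter_append, List.filter_cons_of_neg (by simp)]
  rw [succFirst_append_cons_iff hu, h1, h2]
  simp only [List.map_append, List.map_cons, List.prod_append, List.prod_cons]
  constructor
  · intro h
    have hmv : m + 1 ∉ v := fun h' =>
      (List.nodup_append.1 ht).2.2 _ h _ (List.mem_cons_of_mem _ h') rfl
    rw [(hcomm v hmv).eq, mul_assoc]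
  · intro h
    rw [← mul_assoc, ← mul_assoc, (hcomm u h).eq]

end Tuples

/-! ### Fiedler products and the repeated factors -/

section FiedlerProducts

open MulOpposite

variable {K 𝒜 : Type*} [CommRing K] [Ring 𝒜] [Algebra K 𝒜] {k : ℕ}

open Classical in
theorem exists_partialFiedler (x : K) (A : ℕ → 𝒜) {t : List ℤ} (ht : t.Nodup)
    (hk : ∀ i : ℤ, i ∈ t ↔ 0 ≤ i ∧ i < k) (d m : ℕ) (hm : m + d + 1 = k) :
    ∃ e f : Fin k → Option ℕ,
      PartialFiedler x A m ((Finset.Ico m (k - 1)).filter (fun j : ℕ => SuccFirst t j)).card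
        ((Finset.Ico m (k - 1)).filter (fun j : ℕ => ¬SuccFirst t j)).card e f
        ((t.filter ((m : ℤ) ≤ ·)).map
          (fun i => stepMatrix k i (A ((k : ℤ) - i).toNat))).prod ∧
      (∀ a : Fin k, m ≤ a → (a : ℕ) + 1 < k → SuccFirst t a → e a = none) ∧
      (∀ a : Fin k, m ≤ a → (a : ℕ) + 1 < k → ¬SuccFirst t a → f a = none) := by
  have hcomm : ∀ i j : ℤ, i + 2 ≤ j → Commute (stepMatrix k i (A ((k : ℤ) - i).toNat))
      (stepMatrix k j (A ((k : ℤ) - j).toNat)) := fun i j hij => stepMatrix_commute (Or.inl hij) _ _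
  induction d generalizing m with
  | zero =>
    -- Here `m = k - 1` and `k` is absent from `t`; `idxOf` of an absent element is the length of
    -- the list.
    have h1 : ¬SuccFirst t m := by
      have : (m : ℤ) + 1 ∉ t := fun h => by have := (hk _).1 h; omega
      rw [SuccFirst, List.idxOf_of_notMem this]
      exact not_lt.2 List.idxOf_le_length
    have h2 : t.filter ((m : ℤ) + 1 ≤ ·) = [] := by
      rw [List.filter_eq_nil_iff]
      intro a ha
      have := (hk a).1 ha
      simp
      omega
    have h3 : ((k : ℤ) - m).toNat = 1 := by omega
    refine ⟨fun a => if (a : ℕ) = m then some 0 else none,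
      fun a => if (a : ℕ) = m then some 0 else none, ?_, fun a h4 h5 => by omega,
      fun a h4 h5 => by omega⟩
    rw [(prod_filter_le_of_succFirst hcomm ht ((hk m).2 (by omega))).2 h1, h2, h3,
      show k - 1 = m by omega]
    simpa using partialFiedler_last x A (by omega)
  | succ d ih =>
    obtain ⟨e, f, hpf, he, hf⟩ := ih (m + 1) (by omega)
    have hsize := hpf.size
    have hIco : Finset.Ico m (k - 1) = insert m (Finset.Ico (m + 1) (k - 1)) := by
      ext j
      simp
      omega
    have hnot : ∀ (p : ℕ → Prop) [DecidablePred p],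
        m ∉ (Finset.Ico (m + 1) (k - 1)).filter p := by simp
    -- The size identity `p + q + 1 + (m + 1) = k` makes the coefficient attached to the index `m`
    -- the one of degree `p + q + 2`.
    have hidx : ((k : ℤ) - m).toNat =
        ((Finset.Ico (m + 1) (k - 1)).filter (fun j : ℕ => SuccFirst t j)).card +
        ((Finset.Ico (m + 1) (k - 1)).filter (fun j : ℕ => ¬SuccFirst t j)).card + 2 := by
      omega
    have hprod := prod_filter_le_of_succFirst hcomm ht ((hk m).2 (by omega))
    simp only [hidx] at hprod
    push_cast at hpf
    obtain ⟨w, hw⟩ : ∃ w : Fin k, (w : ℕ) = m := ⟨⟨m, by omega⟩, rfl⟩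
    have hgt : ∀ a : Fin k, m ≤ a → a ≠ w → m + 1 ≤ a := by
      intro a h1 h2
      have : (a : ℕ) ≠ m := fun h => h2 (Fin.ext (h.trans hw.symm))
      omega
    set p := ((Finset.Ico (m + 1) (k - 1)).filter (fun j : ℕ => SuccFirst t j)).card
    set q := ((Finset.Ico (m + 1) (k - 1)).filter (fun j : ℕ => ¬SuccFirst t j)).card
    by_cases hs : SuccFirst t m
    · refine ⟨e, Function.update f w (some (p + 1)), ?_, ?_, ?_⟩
      · rw [hprod.1 hs, hIco, Finset.filter_insert, Finset.filter_insert, if_pos hs,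
          if_neg (not_not.2 hs), Finset.card_insert_of_notMem (hnot _)]
        exact hpf.mul_stepMatrix w hw
      · intro a h1 h2 h3
        by_cases ha : a = w
        · subst ha
          exact hpf.supp_row _ (by omega)
        · exact he a (hgt a h1 ha) h2 h3
      · intro a h1 h2 h3
        have ha : a ≠ w := by rintro rfl; exact h3 (hw ▸ hs)
        rw [Function.update_of_ne ha]
        exact hf a (hgt a h1 ha) h2 h3
    · refine ⟨Function.update e w (some (q + 1)), f, ?_, ?_, ?_⟩
      · rw [hprod.2 hs, hIco, Finset.filter_insert, Finset.filter_insert, if_neg hs,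
          if_pos hs, Finset.card_insert_of_notMem (hnot _)]
        exact hpf.stepMatrix_mul w hw
      · intro a h1 h2 h3
        have ha : a ≠ w := by rintro rfl; exact hs (hw ▸ h3)
        rw [Function.update_of_ne ha]
        exact he a (hgt a h1 ha) h2 h3
      · intro a h1 h2 h3
        by_cases ha : a = w
        · subst ha
          exact hpf.supp_col _ (by omega)
        · exact hf a (hgt a h1 ha) h2 h3

/-- If the row `j` is a wing row, then multiplication by `stepMatrix k j B` preserves the wing
structure; the rows `j - 1` and `j` are interchanged. -/
theorem WingStructure.stepMatrix_mul {x : K} {e f : Fin k → Option ℕ}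
    {L : Matrix (Fin k) (Fin k) 𝒜} {T : 𝒜} (h : WingStructure x 0 e f L T) (w : Fin k)
    (hw : e w = none) (B : 𝒜) :
    ∃ σ : Equiv.Perm (Fin k), WingStructure x 0 (e ∘ σ) f (stepMatrix k (w : ℤ) B * L) T ∧
      (∀ a : Fin k, a ≠ w → (a : ℕ) + 1 ≠ w → σ a = a) ∧ (∀ a : Fin k, (a : ℕ) + 1 = w → σ a = w) := by
  rcases Nat.eq_zero_or_pos (w : ℕ) with hw0 | hw0
  -- Row `0` is only scaled: `B * L = L + (B - 1) * L`, so no rows change places.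
  · refine ⟨1, h.rowOp 1 w hw (fun a => if a = w then B - 1 else 0) fun a b => ?_,
      fun _ _ _ => rfl, fun a ha => by omega⟩
    by_cases haw : a = w
    · subst haw
      rw [hw0, Nat.cast_zero, stepMatrix_zero_mul_apply_self (by omega)]
      simp [sub_mul]
    · have : (a : ℕ) ≠ w := fun h' => haw (Fin.ext h')
      rw [stepMatrix_mul_apply_of_ne (by omega) (by omega)]
      simp [haw]
  · obtain ⟨c, hc⟩ : ∃ c : Fin k, (c : ℕ) + 1 = w := ⟨⟨w - 1, by omega⟩, by simp only; omega⟩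
    have hcw : c ≠ w := by rintro rfl; omega
    refine ⟨Equiv.swap c w, h.rowOp _ w hw (fun a => if a = w then B else 0) fun a b => ?_,
      fun a h1 h2 => ?_, fun a ha => ?_⟩
    · by_cases haw : a = w
      · subst haw
        rw [stepMatrix_mul_apply_self (c := c) rfl (by omega)]
        simp
      · have h1 : (a : ℕ) ≠ w := fun h' => haw (Fin.ext h')
        by_cases hac : a = c
        · subst hac
          rw [stepMatrix_mul_apply_pred (w := w) rfl (by omega)]
          simp [haw]
        · have h2 : (a : ℕ) ≠ c := fun h' => hac (Fin.ext h')
          rw [stepMatrix_mul_apply_of_ne (by omega) (by omega), Equiv.swap_apply_of_ne_of_ne hac haw]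
          simp [haw]
    · refine Equiv.swap_apply_of_ne_of_ne ?_ h1
      rintro rfl
      exact h2 hc
    · have : a = c := Fin.ext (by omega)
      rw [this, Equiv.swap_apply_left]

/-- Multiplication from the left by the elementary matrices of a tuple `s` such that `(s, t)`
satisfies the SIP preserves the wing structure, if all rows `j` with `j + 1` before `j` in `t` are
wing rows. -/
theorem WingStructure.zipWith_mul {x : K} {q : ℕ} {e f : Fin k → Option ℕ}
    {L : Matrix (Fin k) (Fin k) 𝒜} {T : 𝒜} (h : WingStructure x 0 e f L T) (he : IsLevel q e)
    (hlast : ∀ a : Fin k, (a : ℕ) + 1 = k → e a = some 0) {t : List ℤ}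
    (hwing : ∀ a : Fin k, (a : ℕ) + 1 < k → SuccFirst t a → e a = none)
    (s : List ℤ) (Bs : List 𝒜) (hlen : Bs.length = s.length) (hs : ∀ i ∈ s, 0 ≤ i ∧ i + 1 < k)
    (hst : ∀ i ∈ s, i ∈ t) (hsip : SIP (s ++ t)) :
    ∃ e' : Fin k → Option ℕ,
      WingStructure x 0 e' f ((List.zipWith (stepMatrix k) s Bs).prod * L) T ∧ IsLevel q e' ∧
      (∀ a : Fin k, (a : ℕ) + 1 = k → e' a = some 0) ∧
      (∀ a : Fin k, (a : ℕ) + 1 < k → SuccFirst (s ++ t) a → e' a = none) ∧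
      (∀ a b : Fin k, (a : ℕ) + 1 = k →
        ((List.zipWith (stepMatrix k) s Bs).prod * L) a b = L a b) := by
  induction s generalizing Bs with
  | nil => exact ⟨e, by simpa using h, he, hlast, by simpa using hwing, by simp⟩
  | cons j s ih =>
    obtain ⟨B, Bs, rfl⟩ := List.exists_cons_of_length_pos (l := Bs) (by simp [hlen])
    obtain ⟨e', h1, h2, h3, h4, h5⟩ := ih Bs (by simpa using hlen)
      (fun i hi => hs i (List.mem_cons_of_mem _ hi)) (fun i hi => hst i (List.mem_cons_of_mem _ hi))
      (SIP.infix (u := [j]) (v := []) (by simpa using hsip))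
    have hj := hs j List.mem_cons_self
    obtain ⟨w, rfl⟩ : ∃ w : Fin k, (w : ℤ) = j := ⟨⟨j.toNat, by omega⟩, by simp only; omega⟩
    -- The index `w` occurs in `t`, so prepending it creates a repetition, and the SIP forces `w +
    -- 1` before the first earlier-placed `w`.
    have hw : e' w = none := h4 w (by omega)
      (hsip.succFirst (List.mem_append_right _ (hst _ List.mem_cons_self)))
    obtain ⟨σ, h6, h7, h8⟩ := h1.stepMatrix_mul w hw B
    rw [List.zipWith_cons_cons, List.prod_cons, Matrix.mul_assoc]
    refine ⟨e' ∘ σ, h6, h2.comp σ, fun a ha => ?_, fun a ha hsucc => ?_, fun a b ha => ?_⟩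
    · have : a ≠ w := by rintro rfl; omega
      rw [Function.comp, h7 a this (by omega)]
      exact h3 a ha
    -- With `w` now in front, the hypothesis fails for `a = w`, holds for `a = w - 1` (which has
    -- received the old wing row `w`), and is unchanged for all other `a`.
    · rw [SuccFirst, List.cons_append, List.idxOf_cons, List.idxOf_cons] at hsucc
      simp only [cond_eq_ite, beq_iff_eq] at hsucc
      have haw : a ≠ w := by
        rintro rfl
        simp at hsucc
      have haw' : (a : ℕ) ≠ w := fun h' => haw (Fin.ext h')
      by_cases hpred : (a : ℕ) + 1 = w
      · rw [Function.comp, h8 a hpred]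
        exact hw
      · rw [Function.comp, h7 a haw hpred]
        refine h4 a ha ?_
        rw [if_neg (by omega), if_neg (by omega)] at hsucc
        exact Nat.lt_of_add_lt_add_right hsucc
    · have : (a : ℕ) ≠ w := by omega
      rw [stepMatrix_mul_apply_of_ne (by omega) (by omega), h5 a b ha]

theorem opTranspose_one : opTranspose (1 : Matrix (Fin k) (Fin k) 𝒜) = 1 := by
  ext a b
  simp [opTranspose, Matrix.one_apply, apply_ite op]

theorem opTranspose_list_prod (l : List (Matrix (Fin k) (Fin k) 𝒜)) :
    opTranspose l.prod = (l.map opTranspose).reverse.prod := by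
  induction l with
  | nil => simp [opTranspose_one]
  | cons M l ih => simp [opTranspose_mul, ih]

theorem opTranspose_zipWith_prod (s : List ℤ) (Bs : List 𝒜) (hlen : Bs.length = s.length) :
    opTranspose (List.zipWith (stepMatrix k) s Bs).prod =
      (List.zipWith (stepMatrix k) s.reverse (Bs.map op).reverse).prod := by
  rw [opTranspose_list_prod, List.map_zipWith, ← List.reverse_zipWith (by simp [hlen]),
    List.zipWith_map_right]
  simp only [opTranspose_stepMatrix]

end FiedlerProducts

/-! ### From wing structures to the block form, and translation of the elementary matrices -/

section Assembly

variable {k : ℕ}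

/-- The body rows, sorted by decreasing level, and the wing rows. -/
theorem IsLevel.exists_equiv {p q : ℕ} {e : Fin k → Option ℕ} (h : IsLevel q e)
    (hk : p + (q + 1) = k) :
    ∃ φ : Fin p ⊕ Fin (q + 1) ≃ Fin k, (∀ i, e (φ (Sum.inl i)) = none) ∧
      ∀ i : Fin (q + 1), e (φ (Sum.inr i)) = some (q - i) := by
  have hsurj : ∀ i : Fin (q + 1), ∃ a, e a = some (q - i) := fun i => h.surj _ (by omega)
  choose g hg using hsurj
  have hbij : Function.Bijective
      (fun i : Fin (q + 1) => (⟨g i, by simp [hg]⟩ : {a : Fin k // ¬e a = none})) := by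
    constructor
    · intro i j hij
      have h1 : g i = g j := congrArg Subtype.val hij
      have h2 := hg i
      rw [h1, hg j] at h2
      simp at h2
      exact Fin.ext (by omega)
    · rintro ⟨a, ha⟩
      obtain ⟨d, hd⟩ := Option.ne_none_iff_exists'.1 ha
      have hdq := h.le a d hd
      refine ⟨⟨q - d, by omega⟩, Subtype.ext (h.inj _ _ d ?_ hd)⟩
      rw [hg]
      simp
      omega
  -- The number of wing rows is not part of `IsLevel`; it is the complement of the `q + 1` body
  -- rows.
  have hcard : Fintype.card {a : Fin k // e a = none} = p := by
    have h1 := Fintype.card_subtype_compl (fun a : Fin k => e a = none)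
    have h2 := Fintype.card_congr (Equiv.ofBijective _ hbij)
    have h3 := Fintype.card_subtype_le (fun a : Fin k => e a = none)
    simp only [Fintype.card_fin] at h1 h2 h3
    omega
  refine ⟨(Equiv.sumCongr (Fintype.equivFinOfCardEq hcard).symm
    (Equiv.ofBijective _ hbij)).trans (Equiv.sumCompl _), fun i => ?_, fun i => ?_⟩
  · simpa using ((Fintype.equivFinOfCardEq hcard).symm i).2
  · simpa using hg i

theorem sum_weight_smul {K V : Type*} [CommRing K] [AddCommGroup V] [Module K V] (x : K) {p q : ℕ}
    {e : Fin k → Option ℕ} (φ : Fin p ⊕ Fin (q + 1) ≃ Fin k)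
    (h1 : ∀ i, e (φ (Sum.inl i)) = none)
    (h2 : ∀ i : Fin (q + 1), e (φ (Sum.inr i)) = some (q - i)) (g : Fin k → V) :
    ∑ a, weight x (e a) • g a = ∑ i : Fin (q + 1), x ^ (q - (i : ℕ)) • g (φ (Sum.inr i)) := by
  rw [← Equiv.sum_comp φ, Fintype.sum_sum_type]
  simp [h1, h2]

variable {F : Type*} [Field F] {n : ℕ}

theorem blockPerm_transpose_mul {R : Type*} [CommRing R] (c : Equiv.Perm (Fin k))
    (L : BlockMatrix k k n R) (a b : Fin k) : ((blockPerm n R c)ᵀ * L) a b = L (c a) b := by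
  simp [Matrix.mul_apply, blockPerm]

theorem mul_blockPerm {R : Type*} [CommRing R] (c : Equiv.Perm (Fin k))
    (L : BlockMatrix k k n R) (a b : Fin k) : (L * blockPerm n R c) a b = L a (c b) := by
  simp [Matrix.mul_apply, blockPerm]

theorem coeff_X_pow_mul_of_natDegree_le_one {g : Polynomial F} (hg : g.natDegree ≤ 1) (d s : ℕ) :
    (Polynomial.X ^ d * g).coeff s =
      (if s = d + 1 then g.coeff 1 else 0) + (if s = d then g.coeff 0 else 0) := by
  rw [Polynomial.coeff_X_pow_mul']
  split_ifs with h1 h2 h3 h3 h2 h3 h3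
  all_goals try omega
  · simp [h2]
  · simp [h3]
  · rw [Polynomial.coeff_eq_zero_of_natDegree_lt (by omega)]
    simp
  · simp

/-- The antidiagonal sums of a pencil `N` are the coefficients of `(Λ_q ⊗ I) N (Λ_p ⊗ I)ᵀ`. -/
theorem antidiagSum_eq {p q : ℕ} {N : BlockMatrix (q + 1) (p + 1) n (Polynomial F)}
    (hN : IsPencil N) (s : ℕ) :
    antidiagSum N s = coeffMatrix (∑ i : Fin (q + 1), (Polynomial.X : Polynomial F) ^ (q - (i : ℕ)) •
      ∑ j : Fin (p + 1), (Polynomial.X : Polynomial F) ^ (p - (j : ℕ)) • N i j) s := by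
  ext u v
  simp only [antidiagSum, coeffMatrix, Matrix.add_apply, Matrix.sum_apply, Matrix.map_apply,
    Matrix.smul_apply, smul_eq_mul, Finset.mul_sum, Polynomial.finsetSum_coeff]
  rw [← Finset.sum_add_distrib]
  refine Finset.sum_congr rfl fun i _ => ?_
  rw [← Finset.sum_add_distrib]
  refine Finset.sum_congr rfl fun j _ => ?_
  rw [← mul_assoc, ← pow_add, coeff_X_pow_mul_of_natDegree_le_one (hN i j u v)]
  congr 1
  -- In positions counted from `1`, this exponent condition is `i + j = k + 2 - s` with `k = p + q +
  -- 1`.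
  · by_cases h : s = q - (i : ℕ) + (p - (j : ℕ)) + 1
    · rw [if_pos h, if_pos (by omega), Matrix.map_apply]
    · rw [if_neg h, if_neg (by omega), Matrix.zero_apply]
  · by_cases h : s = q - (i : ℕ) + (p - (j : ℕ))
    · rw [if_pos h, if_pos (by omega), Matrix.map_apply]
    · rw [if_neg h, if_neg (by omega), Matrix.zero_apply]

/-- A pencil with a wing structure becomes a block matrix `[0, L₁; L₂ᵀ, N]` with wing pencils `L₁`
and `L₂` after permutations of the rows and of the columns. -/
theorem WingStructure.exists_reversedPencil {p q : ℕ} {e f : Fin k → Option ℕ}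
    {L : BlockMatrix k k n (Polynomial F)} {T : Matrix (Fin n) (Fin n) (Polynomial F)}
    (h : WingStructure (Polynomial.X : Polynomial F) 0 e f L T) (hL : IsPencil L)
    (he : IsLevel q e) (hf : IsLevel p f) (hrow : p + (q + 1) = k) (hcol : q + (p + 1) = k)
    (z : Fin k) (hz : (z : ℕ) + 1 = k) (hez : e z = some 0) (hfz : f z = some 0) :
    ∃ (l r : Equiv.Perm (Fin k)) (L₁ : BlockMatrix p (p + 1) n (Polynomial F))
      (L₂ : BlockMatrix q (q + 1) n (Polynomial F))
      (N : BlockMatrix (q + 1) (p + 1) n (Polynomial F)),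
      (blockPerm n (Polynomial F) l)ᵀ * L * blockPerm n (Polynomial F) r =
        reversedPencil hrow hcol L₁ L₂ N ∧
      IsWingPencil L₁ ∧ IsWingPencil L₂ ∧ IsPencil N ∧
      (∀ s, antidiagSum N s = coeffMatrix T s) ∧ l z = z ∧ r z = z ∧
      N (Fin.last q) (Fin.last p) = L z z := by
  obtain ⟨φ, hφ1, hφ2⟩ := he.exists_equiv hrow
  obtain ⟨ψ, hψ1, hψ2⟩ := hf.exists_equiv hcol
  -- The last position carries the level `q - q = 0`, which `z` alone attains; this is why the
  -- permutations fix the last index.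
  have hφz : φ (Sum.inr (Fin.last q)) = z := he.inj _ _ 0 (by simp [hφ2]) hez
  have hψz : ψ (Sum.inr (Fin.last p)) = z := hf.inj _ _ 0 (by simp [hψ2]) hfz
  have hN : IsPencil (Matrix.of fun i j => L (φ (Sum.inr i)) (ψ (Sum.inr j)) :
      BlockMatrix (q + 1) (p + 1) n (Polynomial F)) := fun i j => hL _ _
  refine ⟨(finSumFinEquiv.trans (finCongr hrow)).symm.trans φ,
    (finSumFinEquiv.trans (finCongr hcol)).symm.trans ψ,
    Matrix.of fun i j => L (φ (Sum.inl i)) (ψ (Sum.inr j)),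
    Matrix.of fun i j => (L (φ (Sum.inr j)) (ψ (Sum.inl i)))ᵀ,
    Matrix.of fun i j => L (φ (Sum.inr i)) (ψ (Sum.inr j)), ?_, ⟨fun i j => hL _ _, ?_⟩,
    ⟨fun i j u v => hL _ _ _ _, ?_⟩, hN, fun s => ?_, ?_, ?_, ?_⟩
  · refine Matrix.ext fun a b => ?_
    rw [mul_blockPerm, blockPerm_transpose_mul]
    simp only [reversedPencil, Matrix.reindex_apply, Matrix.submatrix_apply, Equiv.trans_apply]
    rcases (finSumFinEquiv.trans (finCongr hrow)).symm a with i | i <;>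
      rcases (finSumFinEquiv.trans (finCongr hcol)).symm b with j | j
    · exact h.zero _ _ (Nat.zero_le _) (Nat.zero_le _) (hφ1 i) (hψ1 j)
    · rfl
    · rfl
    · rfl
  · refine Matrix.ext fun i j => ?_
    have := h.row (φ (Sum.inl i)) (Nat.zero_le _) (hφ1 i)
    rw [sum_weight_smul _ ψ hψ1 hψ2] at this
    simpa [Matrix.mul_apply, Lam] using this
  · refine Matrix.ext fun i j => ?_
    have := h.col (ψ (Sum.inl i)) (Nat.zero_le _) (hψ1 i)
    rw [sum_weight_smul _ φ hφ1 hφ2] at this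
    simpa [Matrix.mul_apply, Lam, Matrix.transpose_sum] using congrArg Matrix.transpose this
  · rw [antidiagSum_eq hN, ← h.total, sum_weight_smul _ φ hφ1 hφ2]
    simp only [sum_weight_smul _ ψ hψ1 hψ2, Matrix.of_apply]
  · rw [Equiv.trans_apply, ← hφz]
    congr 1
    rw [Equiv.symm_apply_eq]
    ext
    simp [hφz]
    omega
  · rw [Equiv.trans_apply, ← hψz]
    congr 1
    rw [Equiv.symm_apply_eq]
    ext
    simp [hψz]
    omega
  · simp [hφz, hψz]

/-- `const` as a ring homomorphism. -/
def constHom (F : Type*) [Field F] (k n : ℕ) :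
    BlockMatrix k k n F →+* BlockMatrix k k n (Polynomial F) :=
  (Polynomial.C.mapMatrix).mapMatrix

theorem const_eq_constHom (M : BlockMatrix k k n F) : const M = constHom F k n M := rfl

/-- The shift by `k` makes the index equal to the position, counted from `0`, of the lower row
involved. The separate case `i = -k` becomes the index `0`, which has no row above. -/
theorem const_elem {i : ℤ} (hi : i ≤ -1) (B : Matrix (Fin n) (Fin n) F) :
    const (elem k i B) = stepMatrix k (k + i) (B.map Polynomial.C) := by
  refine Matrix.ext fun a b => ?_
  have ha := a.2
  have hb := b.2
  simp only [const, elem, stepMatrix, Matrix.map_apply, Matrix.of_apply, Fin.ext_iff]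
  have e0 : (0 : Matrix (Fin n) (Fin n) F).map (Polynomial.C : F → Polynomial F) = 0 := by simp
  have e1 : (1 : Matrix (Fin n) (Fin n) F).map (Polynomial.C : F → Polynomial F) = 1 := by simp
  split_ifs <;> first | rfl | exact e0 | exact e1 | (exfalso; omega)

theorem const_elemP_zero (P : Matrix (Fin n) (Fin n) (Polynomial F)) :
    const (elemP k P 0) =
      Matrix.diagonal (constDiag k (fun s => (coeffMatrix P s).map Polynomial.C)) := by
  refine Matrix.ext fun a b => ?_
  have ha := a.2
  have hb := b.2
  have e0 : (0 : Matrix (Fin n) (Fin n) F).map (Polynomial.C : F → Polynomial F) = 0 := by simp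
  have e1 : (1 : Matrix (Fin n) (Fin n) F).map (Polynomial.C : F → Polynomial F) = 1 := by simp
  simp only [const, elemP, elem, Matrix.map_apply, Matrix.of_apply, le_refl, if_true,
    Matrix.diagonal_apply, constDiag, Fin.ext_iff]
  split_ifs <;> first | exact e0 | exact e1 | (exfalso; omega) | skip
  ext
  simp

theorem const_elemProd (s : List ℤ) (Bs : List (Matrix (Fin n) (Fin n) F))
    (hs : ∀ i ∈ s, -(k : ℤ) ≤ i ∧ i ≤ -1) :
    const (elemProd k s Bs) = (List.zipWith (stepMatrix k) (shift k s)
      (Bs.map (fun B => B.map (Polynomial.C : F → Polynomial F)))).prod := by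
  induction s generalizing Bs with
  | nil => simp [elemProd, shift, const_eq_constHom]
  | cons i s ih =>
    rcases Bs with _ | ⟨B, Bs⟩
    · simp [elemProd, const_eq_constHom]
    · have h1 := ih Bs fun j hj => hs j (List.mem_cons_of_mem _ hj)
      have h2 := hs i List.mem_cons_self
      have h3 := const_elem (k := k) (n := n) h2.2 B
      simp only [const_eq_constHom, elemProd] at h1 h3 ⊢
      rw [List.zipWith_cons_cons, List.prod_cons, map_mul, h1, h3]
      rfl

theorem const_elemProdP (P : Matrix (Fin n) (Fin n) (Polynomial F)) (s : List ℤ)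
    (hs : ∀ i ∈ s, -(k : ℤ) ≤ i ∧ i ≤ -1) :
    const (elemProdP k P s) = ((shift k s).map (fun i => stepMatrix k i
      ((coeffMatrix P ((k : ℤ) - i).toNat).map (Polynomial.C : F → Polynomial F)))).prod := by
  rw [const_eq_constHom, elemProdP, map_list_prod, List.map_map, shift, List.map_map]
  congr 1
  refine List.map_congr_left fun i hi => ?_
  have h := hs i hi
  simp only [Function.comp]
  rw [← const_eq_constHom, elemP, if_neg (by omega), const_elem h.2,
    show ((k : ℤ) - (k + i)).toNat = i.natAbs by omega]

theorem isPencil_leftPencil (P : Matrix (Fin n) (Fin n) (Polynomial F)) (z lz rz : List ℤ)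
    (Z W : List (Matrix (Fin n) (Fin n) F)) : IsPencil (leftPencil k P z lz rz Z W) := by
  have : leftPencil k P z lz rz Z W =
      (Polynomial.X : Polynomial F) •
        const (elemProd k lz Z * elemProdP k P z * elemProd k rz W) -
      const (elemProd k lz Z * elemP k P 0 * elemProd k rz W) := by
    simp only [leftPencil, const_eq_constHom, map_mul]
    simp only [Matrix.mul_sub, Matrix.sub_mul, Matrix.mul_smul, Matrix.smul_mul]
  intro i j u v
  rw [this]
  simp only [Matrix.sub_apply, Matrix.smul_apply, const, Matrix.map_apply, smul_eq_mul]
  refine (Polynomial.natDegree_sub_le _ _).trans (max_le ?_ (by simp))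
  compute_degree

end Assembly

/-! ### The wing structure of a generalized Fiedler pencil with repetition -/

section Main

open MulOpposite

variable {F : Type*} [Field F] {n k : ℕ}

theorem mem_shift {i j : ℤ} {t : List ℤ} : j ∈ shift i t ↔ j - i ∈ t := by
  simp only [shift, List.mem_map]
  constructor
  · rintro ⟨a, ha, rfl⟩
    simpa using ha
  · intro h
    exact ⟨_, h, by ring⟩

theorem exists_wingStructure_leftPencil (hk : 2 ≤ k)
    (P : Matrix (Fin n) (Fin n) (Polynomial F)) {z lz rz : List ℤ} (hz_nodup : z.Nodup)
    (hz : ∀ i : ℤ, i ∈ z ↔ -(k : ℤ) ≤ i ∧ i ≤ -1)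
    (hlz : ∀ i ∈ lz, -(k : ℤ) ≤ i ∧ i ≤ -2) (hrz : ∀ i ∈ rz, -(k : ℤ) ≤ i ∧ i ≤ -2)
    (hSIP : SIP (lz ++ z ++ rz)) {Z W : List (Matrix (Fin n) (Fin n) F)}
    (hZ : Z.length = lz.length) (hW : W.length = rz.length) :
    ∃ (p q : ℕ) (e f : Fin k → Option ℕ), p + 1 = numHeads (shift k z) ∧
      q + 1 = numHeads (shift k z).reverse ∧ p + q + 1 = k ∧ IsLevel q e ∧ IsLevel p f ∧
      (∀ a : Fin k, (a : ℕ) + 1 = k → e a = some 0 ∧ f a = some 0 ∧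
        leftPencil k P z lz rz Z W a a =
          (coeffMatrix P 1).map (fun c => (Polynomial.X : Polynomial F) * Polynomial.C c) +
            (coeffMatrix P 0).map Polynomial.C) ∧
      WingStructure (Polynomial.X : Polynomial F) 0 e f (leftPencil k P z lz rz Z W)
        (∑ s ∈ Finset.range (k + 1),
          (Polynomial.X : Polynomial F) ^ s • (coeffMatrix P s).map Polynomial.C) := by
  classical
  set A : ℕ → Matrix (Fin n) (Fin n) (Polynomial F) :=
    fun s => (coeffMatrix P s).map Polynomial.C with hA
  set t := shift k z with ht
  have hmem : ∀ i : ℤ, i ∈ t ↔ 0 ≤ i ∧ i < k := by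
    intro i
    rw [ht, mem_shift, hz]
    omega
  have hnd : t.Nodup := hz_nodup.map (add_right_injective (k : ℤ))
  have hnd' : t.reverse.Nodup := List.nodup_reverse.2 hnd
  have hmem' : ∀ i : ℤ, i ∈ t.reverse ↔ 0 ≤ i ∧ i < k := by simpa using hmem
  obtain ⟨e, f, hpf, he, hf⟩ := exists_partialFiedler (Polynomial.X : Polynomial F) A hnd hmem
    (k - 1) 0 (by omega)
  have hrev : ∀ j : ℕ, j + 1 < k → (SuccFirst t.reverse j ↔ ¬SuccFirst t j) := fun j hj =>
    succFirst_reverse_iff hnd ((hmem _).2 (by omega)) ((hmem _).2 (by omega))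
  rw [List.filter_eq_self.2 (fun a ha => by simpa using ((hmem a).1 ha).1)] at hpf
  set p := ((Finset.Ico 0 (k - 1)).filter (fun j : ℕ => SuccFirst t j)).card with hp
  set q := ((Finset.Ico 0 (k - 1)).filter (fun j : ℕ => ¬SuccFirst t j)).card with hq
  have hsize := hpf.size
  have hp' : p + 1 = numHeads t := (numHeads_eq hnd hmem (by omega)).symm
  have hq' : q + 1 = numHeads t.reverse := by
    rw [numHeads_eq hnd' hmem' (by omega), hq]
    congr 2
    refine Finset.filter_congr fun j hj => (hrev j ?_).symm
    have := (Finset.mem_Ico.1 hj).2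
    omega
  have hsip : SIP (shift k lz ++ t ++ shift k rz) := by
    simpa [shift, ht] using hSIP.shift k
  have hbound : ∀ s : List ℤ, (∀ i ∈ s, -(k : ℤ) ≤ i ∧ i ≤ -2) →
      ∀ i ∈ shift k s, 0 ≤ i ∧ i + 1 < k := by
    intro s hs i hi
    have := hs _ (mem_shift.1 hi)
    omega
  have hL := hpf.wings
  rw [← const_elemP_zero P, ← const_elemProdP P z (fun i hi => (hz i).1 hi)] at hL
  obtain ⟨e', h1, h2, h3, -, h5⟩ := hL.zipWith_mul hpf.level_row
    (fun a ha => (hpf.last a ha).1) (t := t) (fun a => he a (Nat.zero_le _)) (shift k lz)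
    (Z.map (fun B => B.map Polynomial.C)) (by simpa [shift] using hZ) (hbound lz hlz)
    (fun i hi => (hmem i).2 (by have := hbound lz hlz i hi; omega)) (SIP.infix (u := []) hsip)
  rw [← const_elemProd lz Z (fun i hi => by have := hlz i hi; omega)] at h1 h5
  -- The columns are treated as rows over the opposite ring: `rz` and `t` are reversed, and by
  -- `hrev` the wing columns are exactly what the reversed tuple requires.
  have h6 := h1.transpose
    (opLinearEquiv (Polynomial F) :
      Matrix (Fin n) (Fin n) (Polynomial F) ≃ₗ[Polynomial F] _).toLinearMap
  obtain ⟨f', g1, g2, g3, -, g5⟩ := h6.zipWith_mul hpf.level_col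
    (fun a ha => (hpf.last a ha).2.1) (t := t.reverse)
    (fun a ha hs => hf a (Nat.zero_le _) ha ((hrev a ha).1 hs))
    (shift k rz).reverse ((W.map (fun B => B.map Polynomial.C)).map op).reverse
    (by simpa [shift] using hW) (fun i hi => hbound rz hrz i (List.mem_reverse.1 hi))
    (fun i hi => (hmem' i).2 (by have := hbound rz hrz i (List.mem_reverse.1 hi); omega))
    (by simpa using (SIP.infix (v := []) (u := shift k lz) (t := t ++ shift k rz)
      (by simpa using hsip)).reverse)
  rw [← opTranspose_zipWith_prod _ _ (by simpa [shift] using hW),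
    ← const_elemProd rz W (fun i hi => by have := hrz i hi; omega)] at g1 g5
  have hpencil : opTranspose (const (elemProd k rz W)) *
      ((const (elemProd k lz Z) * ((Polynomial.X : Polynomial F) • const (elemProdP k P z) -
        const (elemP k P 0)))ᵀ.map op) = opTranspose (leftPencil k P z lz rz Z W) := by
    rw [leftPencil, opTranspose_mul]
    rfl
  refine ⟨p, q, e', f', hp', hq', by omega, h2, g2, fun a ha => ⟨h3 a ha, g3 a ha, ?_⟩, ?_⟩
  -- The right factor does not affect the last column and the left factor does not affect the last
  -- row. The corner is therefore that of the Fiedler pencil, `X • A 1 - (-A 0)`.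
  · have e1 := g5 a a ha
    have e2 := (congrFun (congrFun hpencil a) a).symm.trans e1
    have e3 : leftPencil k P z lz rz Z W a a =
        (const (elemProd k lz Z) * ((Polynomial.X : Polynomial F) • const (elemProdP k P z) -
          const (elemP k P 0))) a a := op_injective e2
    rw [e3, h5 a a ha, Matrix.sub_apply, Matrix.smul_apply, const_elemP_zero,
      const_elemProdP P z (fun i hi => (hz i).1 hi), (hpf.last a ha).2.2,
      Matrix.diagonal_apply_eq, constDiag, if_pos ha, sub_neg_eq_add]
    rfl
  · have e1 := g1.transpose
      (opLinearEquiv (Polynomial F) :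
        Matrix (Fin n) (Fin n) (Polynomial F) ≃ₗ[Polynomial F] _).symm.toLinearMap
    rw [show p + q + 2 = k + 1 by omega] at e1
    convert e1 using 1
    · exact congrArg (fun M => Mᵀ.map unop) hpencil.symm
    · rfl

end Main

end GFPR

end

theorem theorem8p3 {F : Type*} [Field F] {n k : ℕ} (hk : 2 ≤ k)
    (P : Matrix (Fin n) (Fin n) (Polynomial F)) (hP : HasGrade P k)
    -- `z` is a permutation of `{-k : -1}`
    (z : List ℤ) (hz_nodup : z.Nodup) (hz : ∀ i : ℤ, i ∈ z ↔ -(k : ℤ) ≤ i ∧ i ≤ -1)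
    -- `ℓ_z` and `r_z` have indices from `{-k : -2}`, and `(ℓ_z, z, r_z)` satisfies the SIP
    (lz rz : List ℤ) (hlz : ∀ i ∈ lz, -(k : ℤ) ≤ i ∧ i ≤ -2)
    (hrz : ∀ i ∈ rz, -(k : ℤ) ≤ i ∧ i ≤ -2) (hSIP : SIP (lz ++ z ++ rz))
    -- matrix assignments for `ℓ_z` and `r_z`
    (Z W : List (Matrix (Fin n) (Fin n) F)) (hZ : Z.length = lz.length)
    (hW : W.length = rz.length) :
    ∃ (l r : Equiv.Perm (Fin k)) (p q : ℕ) (hrow : p + (q + 1) = k) (hcol : q + (p + 1) = k)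
      (L₁ : BlockMatrix p (p + 1) n (Polynomial F))
      (L₂ : BlockMatrix q (q + 1) n (Polynomial F))
      (N : BlockMatrix (q + 1) (p + 1) n (Polynomial F))
      (L C : BlockMatrix k k n (Polynomial F)),
      -- the block sizes
      p + 1 = numHeads (shift k z) ∧ q + 1 = numHeads (shift k z).reverse ∧
      -- the given pencil, and the permuted pencil with its block structure
      L = leftPencil k P z lz rz Z W ∧
      C = (blockPerm n (Polynomial F) l)ᵀ * L * blockPerm n (Polynomial F) r ∧
      C = reversedPencil hrow hcol L₁ L₂ N ∧
      IsWingPencil L₁ ∧ IsWingPencil L₂ ∧ IsPencil N ∧ ASCondition N P ∧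
      -- the permutations fix the last block-row and the last block-column
      l ⟨k - 1, by omega⟩ = ⟨k - 1, by omega⟩ ∧ r ⟨k - 1, by omega⟩ = ⟨k - 1, by omega⟩ ∧
      (∀ j : Fin k, C ⟨k - 1, by omega⟩ j =
        (L * blockPerm n (Polynomial F) r) ⟨k - 1, by omega⟩ j) ∧
      (∀ i : Fin k, C i ⟨k - 1, by omega⟩ =
        ((blockPerm n (Polynomial F) l)ᵀ * L) i ⟨k - 1, by omega⟩) ∧
      -- the corner entry
      N (Fin.last q) (Fin.last p) =
        (coeffMatrix P 1).map (fun a => (Polynomial.X : Polynomial F) * Polynomial.C a) +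
          (coeffMatrix P 0).map Polynomial.C := by
  obtain ⟨p, q, e, f, hp, hq, hk', he, hf, hlast, hwing⟩ :=
    exists_wingStructure_leftPencil hk P hz_nodup hz hlz hrz hSIP hZ hW
  have hz0 : ((⟨k - 1, by omega⟩ : Fin k) : ℕ) + 1 = k := by
    simp only
    omega
  obtain ⟨he0, hf0, hcorner⟩ := hlast _ hz0
  have hrow : p + (q + 1) = k := by omega
  have hcol : q + (p + 1) = k := by omega
  obtain ⟨l, r, L₁, L₂, N, h1, h2, h3, h4, h5, h6, h7, h8⟩ := hwing.exists_reversedPencil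
    (isPencil_leftPencil P z lz rz Z W) he hf hrow hcol _ hz0 he0 hf0
  refine ⟨l, r, p, q, hrow, hcol, L₁, L₂, N, _, _, hp, hq, rfl, rfl, h1, h2, h3, h4,
    fun s hs => ?_, h6, h7, fun j => ?_, fun i => ?_, h8.trans hcorner⟩
  -- The total is `∑ X ^ s • A_s` over `s ≤ k`, so its coefficient at `s` is `A_s`.
  · rw [h5]
    ext u v
    simp only [coeffMatrix, Matrix.sum_apply, Matrix.smul_apply, Matrix.map_apply, smul_eq_mul,
      Polynomial.finsetSum_coeff, Polynomial.X_pow_mul, Polynomial.coeff_C_mul_X_pow]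
    rw [Finset.sum_ite_eq, if_pos (Finset.mem_range.2 (by omega))]
  · rw [mul_blockPerm, mul_blockPerm, blockPerm_transpose_mul, h6]
  · rw [mul_blockPerm, h7]
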